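/- Let $p\in[1,\infty)$ and let $\ell_p$ be the space of $p$-summable sequences $x=(a_0,a_1,a_2,\dots)$ of scalars from $\mathbb K$, where $\mathbb K=\mathbb R$ or $\mathbb K=\mathbb C$, with its usual norm. A sequence $\{\mathfrak M_n\}_{n=0}^\infty$ of nonzero closed linear subspaces of a Banach space $E$ is called a Schauder decomposition of $E$ if every $x\in E$ has a unique norm convergent expansion $x=\sum_{n=0}^\infty x_n$ with $x_n\in\mathfrak M_n$ for all $n$; the maps $P_n x:=x_n$ are its associated coordinate projections. It is called unconditional if all these expansions converge unconditionally, and unconditional with constant $M\ge 1$ if $$\Big\|\sum_{i=0}^n\delta_i y_i\Big\|\le M\Big\|\sum_{i=0}^n y_i\Big\|$$ for all $n\ge 0$, $y_i\in\mathfrak M_i$ and $\delta_i\in\{0,1\}$ ($i=0,\dots,n$). Two Schauder decompositions $\{\mathfrak M_n\}$ and $\{\mathfrak N_n\}$ of $E$ are called isomorphic if there is a bounded linear bijection $S:E\to E$ with bounded inverse such that $\mathfrak N_n=S\mathfrak M_n$ for all $n\ge 0$. **Theorem.** Let $\{\mathfrak M_n\}_{n=0}^\infty$ be a Schauder decomposition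 of $\ell_p$ that is unconditional with constant $M$, let $\{P_n\}_{n=0}^\infty$ be its associated coordinate projections, and suppose that for some $m$ $$P_0x=(a_0,a_1,\dots,a_{m-1},0,0,\dots)\qquad\text{for every } x=(a_0,a_1,a_2,\dots)\in\ell_p .$$ Let $\{J_n\}_{n=0}^\infty$ be a sequence of nonzero bounded linear projections in $\ell_p$ such that $J_nJ_k=0$ for $n\ne k$ and $\dim J_0(\ell_p)=m$. Then the following hold. (i) If $p\in[1,2]$ and there is a constant $\varsigma_1\in\left[0,(2M)^{-1}\right)$ such that $$\Big(\sum_{n=1}^\infty\|P_n(J_n-P_n)x\|^p\Big)^{1/p}\le\varsigma_1\|x\|\qquad\text{for every }x\in\ell_p,$$ then $\{J_n(\ell_p)\}_{n=0}^\infty$ is also an unconditional Schauder decomposition of $\ell_p$, and it is isomorphic to $\{\mathfrak M_n\}_{n=0}^\infty$. (ii) If $p\in[2,\infty)$ and there is a constant $$\varsigma_2\in\left[0,\ \frac{1}{\sqrt8\,M}\left(\frac{\Gamma\left(\frac{p+1}{2}\right)}{\sqrt\pi}\right)^{-1/p}\right)$$ such that $$\Big(\sum_{n=1}^\infty\|P_n(J_n-P_n)x\|^2\Big)^{1/2}\le\varsigma_2\|x\|\qquad\text{for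 every }x\in\ell_p,$$ then $\{J_n(\ell_p)\}_{n=0}^\infty$ is also an unconditional Schauder decomposition of $\ell_p$, and it is isomorphic to $\{\mathfrak M_n\}_{n=0}^\infty$. -/

import Mathlib

open scoped ENNReal

section SchauderDecompositions

variable {𝕜 E : Type*} [RCLike 𝕜] [NormedAddCommGroup E] [NormedSpace 𝕜 E]

/-- `x = ∑ u n` is an expansion of `x` along the subspaces `𝔐 n`: the terms satisfy `u n ∈ 𝔐 n`
and the partial sums, taken in the natural order, converge to `x` in norm. -/
def IsExpansion (𝔐 : ℕ → Submodule 𝕜 E) (x : E) (u : ℕ → E) : Prop :=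
  (∀ n, u n ∈ 𝔐 n) ∧
    Filter.Tendsto (fun N : ℕ => ∑ i ∈ Finset.range N, u i) Filter.atTop (nhds x)

/-- A Schauder decomposition: a sequence of nonzero closed subspaces such that every vector has a
unique norm convergent expansion along them. -/
structure IsSchauderDecomposition (𝔐 : ℕ → Submodule 𝕜 E) : Prop where
  ne_bot : ∀ n, 𝔐 n ≠ ⊥
  isClosed : ∀ n, IsClosed (𝔐 n : Set E)
  existsUnique_expansion : ∀ x : E, ∃! u : ℕ → E, IsExpansion 𝔐 x u

/-- A Schauder decomposition is unconditional if all the expansions converge unconditionally.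
(`Summable` is convergence of the net of finite partial sums, that is, unconditional
convergence.) -/
structure IsUnconditionalSchauderDecomposition (𝔐 : ℕ → Submodule 𝕜 E) : Prop
    extends IsSchauderDecomposition 𝔐 where
  summable_expansion : ∀ (x : E) (u : ℕ → E), IsExpansion 𝔐 x u → Summable u

/-- A Schauder decomposition is unconditional with constant `M ≥ 1` if deleting terms from a finite
sum of vectors `y i ∈ 𝔐 i` increases the norm at most by the factor `M`. -/
structure IsUnconditionalSchauderDecompositionWith (𝔐 : ℕ → Submodule 𝕜 E) (M : ℝ) : Prop
    extends IsSchauderDecomposition 𝔐 where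
  one_le : 1 ≤ M
  norm_sum_le : ∀ (n : ℕ) (y : ℕ → E) (δ : ℕ → 𝕜), (∀ i, y i ∈ 𝔐 i) →
    (∀ i, δ i = 0 ∨ δ i = 1) →
    ‖∑ i ∈ Finset.range (n + 1), δ i • y i‖ ≤ M * ‖∑ i ∈ Finset.range (n + 1), y i‖

/-- `P` is the associated sequence of coordinate projections: `n ↦ P n x` is the expansion of `x`
along the decomposition, for every `x`. -/
def IsCoordinateProjections (𝔐 : ℕ → Submodule 𝕜 E) (P : ℕ → E →ₗ[𝕜] E) : Prop :=
  ∀ x : E, IsExpansion 𝔐 x (fun n => P n x)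

/-- Two sequences of subspaces are isomorphic if one linear homeomorphism of the space onto itself
carries `𝔐 n` onto `𝔑 n` for every `n`. -/
def AreIsomorphicDecompositions (𝔐 𝔑 : ℕ → Submodule 𝕜 E) : Prop :=
  ∃ S : E ≃L[𝕜] E, ∀ n, 𝔑 n = (𝔐 n).map (S : E →ₗ[𝕜] E)

end SchauderDecompositions

open MeasureTheory Set Filter Topology ProbabilityTheory
open Real (cos sin exp)
open scoped Real

/-! ### Perturbation of an unconditional decomposition in a Banach space. -/

section Abstract

variable {𝕜 E : Type*} [RCLike 𝕜] [NormedAddCommGroup E] [NormedSpace 𝕜 E]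
  {𝔐 : ℕ → Submodule 𝕜 E} {M : ℝ} {P : ℕ → E →ₗ[𝕜] E}

/-! Put W = ∑ P_n J_n. The relations between the J_n give W J_n = P_n W, so once W is invertible,
W⁻¹ carries 𝔐_n onto the range of J_n and both conclusions follow. Write W = 1 + A + P_0 (J_0 − P_0)
with A = ∑_{n ≥ 1} P_n (J_n − P_n). If ‖A‖ < 1, then W is a finite rank perturbation of an
invertible operator, hence bijective as soon as it is injective, and injectivity is a dimension
count (`isUnconditional_and_areIsomorphic_of_norm_sum_le`).

To get ‖A‖ < 1 one needs ‖∑ y_i‖ ≤ K (∑ ‖y_i‖^q)^(1/q) for y_i ∈ 𝔐_i. Unconditionality compares the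
sum with every signed sum at the cost of a factor 2M, and averaging over signs leaves a type
estimate in ℓ_p. For p ≤ 2 one takes q = p with type constant 1. For p ≥ 2 one takes q = 2, and the
constant comes from Khintchine's inequality with the Gaussian (best) constant,
`signMean_abs_rpow_le`, which is the bulk of the proof.

For 2 < p < 4, |x|^p is a positive multiple of ∫ (cos (xt) − 1 + x²t²/2) t^(−p−1) dt over t > 0.
Averaging over signs and over a Gaussian variable, with ∑ a_i² = 1, the claim becomes ∫ (∏ cos (a_i
t) − exp (−t²/2)) t^(−p−1) dt ≤ 0. Weighted AM-GM with weights a_i² splits the product into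
one-variable problems for |cos u|^s − exp (−s u²/2), s = 1/a_i². For s near 1 the tail past π/2 is
too heavy for this bound; but when a_i t is slightly beyond π/2 only that cosine is negative, the
product is nonpositive, and the stretch can be discarded. `cosSubGauss` encodes this. Its single
sign change reduces the weight to u⁻³, where the gain near the origin is 1/12 and the tail is less
than 1/12. The range p ≥ 4 follows by steps of 2 from `signMean_mul_le`, a discrete integration by
parts that is an equality for Gaussians. -/

theorem IsCoordinateProjections.mem (hP : IsCoordinateProjections 𝔐 P) (n : ℕ) (x : E) :
    P n x ∈ 𝔐 n := (hP x).1 n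

theorem isExpansion_single {n : ℕ} {y : E} (hy : y ∈ 𝔐 n) :
    IsExpansion 𝔐 y (fun k => if k = n then y else 0) := by
  refine ⟨fun k => ?_, tendsto_atTop_of_eventually_const (i₀ := n + 1) fun N hN => ?_⟩
  · dsimp only
    split_ifs with h
    · exact h ▸ hy
    · exact zero_mem _
  · rw [Finset.sum_ite_eq' (Finset.range N) n fun _ => y, if_pos (Finset.mem_range.2 (by omega))]

theorem IsCoordinateProjections.apply_of_mem (hP : IsCoordinateProjections 𝔐 P)
    (h𝔐 : IsSchauderDecomposition 𝔐) {n : ℕ} {y : E} (hy : y ∈ 𝔐 n) (k : ℕ) :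
    P k y = if k = n then y else 0 :=
  congrFun ((h𝔐.existsUnique_expansion y).unique (hP y) (isExpansion_single hy)) k

theorem IsCoordinateProjections.ext (hP : IsCoordinateProjections 𝔐 P) {x y : E}
    (h : ∀ k, P k x = P k y) : x = y := by
  refine tendsto_nhds_unique (hP x).2 ?_
  simp only [h]
  exact (hP y).2

theorem IsUnconditionalSchauderDecompositionWith.norm_sum_subset_le
    (h𝔐 : IsUnconditionalSchauderDecompositionWith 𝔐 M) {A s : Finset ℕ} (hA : A ⊆ s) {y : ℕ → E}
    (hy : ∀ i, y i ∈ 𝔐 i) : ‖∑ i ∈ A, y i‖ ≤ M * ‖∑ i ∈ s, y i‖ := by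
  have hs : s ⊆ Finset.range (s.sup id + 1) := fun i hi =>
    Finset.mem_range.2 (Nat.lt_succ_of_le (Finset.le_sup (f := id) hi))
  -- Padding y by zeros off s turns the sum over s into a sum over an initial range.
  have h := h𝔐.norm_sum_le (s.sup id) (fun i => if i ∈ s then y i else 0)
    (fun i => if i ∈ A then 1 else 0) (fun i => by
      split_ifs
      · exact hy i
      · exact zero_mem _) (fun i => by by_cases hi : i ∈ A <;> simp [hi])
  have e1 : ∑ i ∈ Finset.range (s.sup id + 1), ((if i ∈ A then 1 else 0 : 𝕜) •
      if i ∈ s then y i else 0) = ∑ i ∈ A, y i := by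
    rw [← Finset.sum_subset (hA.trans hs) fun i _ hi => by simp [hi]]
    exact Finset.sum_congr rfl fun i hi => by simp [hi, hA hi]
  have e2 : ∑ i ∈ Finset.range (s.sup id + 1), (if i ∈ s then y i else 0) = ∑ i ∈ s, y i := by
    rw [← Finset.sum_subset hs fun i _ hi => by simp [hi]]
    exact Finset.sum_congr rfl fun i hi => by simp [hi]
  rwa [e1, e2] at h

theorem IsUnconditionalSchauderDecompositionWith.norm_sum_proj_le
    (h𝔐 : IsUnconditionalSchauderDecompositionWith 𝔐 M) (hP : IsCoordinateProjections 𝔐 P)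
    (A : Finset ℕ) (x : E) : ‖∑ i ∈ A, P i x‖ ≤ M * ‖x‖ := by
  refine ge_of_tendsto (((hP x).2.norm).const_mul M) ?_
  filter_upwards [eventually_ge_atTop (A.sup id + 1)] with N hN
  refine h𝔐.norm_sum_subset_le (fun i hi => Finset.mem_range.2 ?_) (fun i => hP.mem i x)
  exact lt_of_lt_of_le (Nat.lt_succ_of_le (Finset.le_sup (f := id) hi)) hN

/-- Subtracting the N-th partial sum from x leaves a vector of small norm with the same coordinates
from N on. The uniform bound M on finite sums of coordinates then gives the Cauchy criterion for
unordered sums. -/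
theorem IsUnconditionalSchauderDecompositionWith.summable_proj [CompleteSpace E]
    (h𝔐 : IsUnconditionalSchauderDecompositionWith 𝔐 M) (hP : IsCoordinateProjections 𝔐 P)
    (x : E) : Summable fun n => P n x := by
  have hM : 0 < M := lt_of_lt_of_le one_pos h𝔐.one_le
  rw [summable_iff_vanishing_norm]
  intro ε hε
  obtain ⟨N, hN⟩ := ((Metric.tendsto_atTop.1 (hP x).2) (ε / M) (by positivity))
  refine ⟨Finset.range N, fun t ht => ?_⟩
  set y := x - ∑ i ∈ Finset.range N, P i x with hy
  have e : ∑ i ∈ t, P i x = ∑ i ∈ t, P i y := by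
    refine Finset.sum_congr rfl fun i hi => ?_
    rw [hy, map_sub, map_sum, Finset.sum_eq_zero, sub_zero]
    intro k hk
    rw [hP.apply_of_mem h𝔐.toIsSchauderDecomposition (hP.mem k x), if_neg]
    rintro rfl
    exact (Finset.disjoint_left.1 ht hi) hk
  rw [e]
  calc _ ≤ M * ‖y‖ := h𝔐.norm_sum_proj_le hP t y
    _ < M * (ε / M) := by
      gcongr
      rw [hy, ← dist_eq_norm, dist_comm]
      exact hN N le_rfl
    _ = ε := by field_simp

theorem IsUnconditionalSchauderDecompositionWith.isUnconditional [CompleteSpace E]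
    (h𝔐 : IsUnconditionalSchauderDecompositionWith 𝔐 M) (hP : IsCoordinateProjections 𝔐 P) :
    IsUnconditionalSchauderDecomposition 𝔐 where
  toIsSchauderDecomposition := h𝔐.toIsSchauderDecomposition
  summable_expansion x u hu := by
    rw [(h𝔐.existsUnique_expansion x).unique hu (hP x)]
    exact h𝔐.summable_proj hP x

theorem isExpansion_map_iff (S : E ≃L[𝕜] E) (x : E) (u : ℕ → E) :
    IsExpansion (fun n => (𝔐 n).map (S : E →ₗ[𝕜] E)) x u ↔
      IsExpansion 𝔐 (S.symm x) (fun n => S.symm (u n)) := by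
  refine and_congr (forall_congr' fun n => ?_) ⟨fun h => ?_, fun h => ?_⟩
  · rw [Submodule.mem_map]
    constructor
    · rintro ⟨y, hy, hyu⟩
      show S.symm (u n) ∈ 𝔐 n
      rw [← hyu]
      simpa using hy
    · exact fun h => ⟨_, h, by simp⟩
  · simpa [Function.comp_def] using (S.symm.continuous.tendsto x).comp h
  · simpa [Function.comp_def] using (S.continuous.tendsto _).comp h

theorem IsUnconditionalSchauderDecomposition.map
    (h𝔐 : IsUnconditionalSchauderDecomposition 𝔐) (S : E ≃L[𝕜] E) :
    IsUnconditionalSchauderDecomposition fun n => (𝔐 n).map (S : E →ₗ[𝕜] E) where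
  ne_bot n h := h𝔐.ne_bot n (Submodule.map_injective_of_injective S.injective
    (h.trans (Submodule.map_bot _).symm))
  isClosed n := by
    have : ((𝔐 n).map (S : E →ₗ[𝕜] E) : Set E) = S '' (𝔐 n : Set E) := rfl
    rw [this]
    exact S.toHomeomorph.isClosedMap _ (h𝔐.isClosed n)
  existsUnique_expansion x := by
    obtain ⟨u, hu, huu⟩ := h𝔐.existsUnique_expansion (S.symm x)
    refine ⟨fun n => S (u n), (isExpansion_map_iff S x _).2 (by simpa using hu), fun v hv => ?_⟩
    have := huu _ ((isExpansion_map_iff S x v).1 hv)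
    funext n
    rw [← this]
    simp
  summable_expansion x u hu := by
    have h := h𝔐.summable_expansion _ _ ((isExpansion_map_iff S x u).1 hu)
    simpa [Function.comp_def] using h.map S S.continuous

/-- Fredholm alternative for a finite rank perturbation of an invertible operator. -/
theorem surjective_of_injective_of_finiteRank {A F : E →L[𝕜] E} (hA : IsUnit A) {R : Submodule 𝕜 E}
    [FiniteDimensional 𝕜 R] (hF : ∀ x, F x ∈ R) (hinj : Function.Injective (A + F)) :
    Function.Surjective (A + F) := by
  obtain ⟨B, rfl⟩ := hA
  set C : E →L[𝕜] E := ↑B⁻¹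
  have hBC (x : E) : (B : E →L[𝕜] E) (C x) = x := by
    have : ((B : E →L[𝕜] E) * C) x = x := by simp [C]
    exact this
  have hCB (x : E) : C ((B : E →L[𝕜] E) x) = x := by
    have : (C * (B : E →L[𝕜] E)) x = x := by simp [C]
    exact this
  let R' := R.map (C : E →ₗ[𝕜] E)
  have hG (x : E) : C (F x) ∈ R' := Submodule.mem_map_of_mem (hF x)
  -- 1 + C F is the identity modulo R' = C R, so it restricts to the finite-dimensional R', where
  -- injective means surjective.
  let T : R' →ₗ[𝕜] R' := (LinearMap.id + (C : E →ₗ[𝕜] E) ∘ₗ (F : E →ₗ[𝕜] E)).restrict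
    fun x hx => R'.add_mem hx (hG x)
  have hT (r : R') : ((T r : R') : E) = (r : E) + C (F r) := rfl
  have hTinj : Function.Injective T := by
    rw [injective_iff_map_eq_zero]
    intro r hr
    have h1 : (r : E) + C (F r) = 0 := by rw [← hT, hr]; rfl
    have h2 : ((B : E →L[𝕜] E) + F) r = 0 := by
      have := congrArg (B : E →L[𝕜] E) h1
      rw [map_add, hBC, map_zero] at this
      exact this
    exact Subtype.ext ((injective_iff_map_eq_zero _).1 hinj _ h2)
  have hTsurj := LinearMap.injective_iff_surjective.1 hTinj
  intro y
  -- C y solves the equation up to the error F (C y) in R; r is the correction.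
  obtain ⟨r, hr⟩ := hTsurj ⟨-C (F (C y)), neg_mem (hG _)⟩
  have hr' : (r : E) + C (F r) = -C (F (C y)) := by rw [← hT, hr]
  refine ⟨C y + r, ?_⟩
  have h1 := congrArg (B : E →L[𝕜] E) hr'
  rw [map_add, map_neg, hBC, hBC] at h1
  rw [add_apply, map_add, map_add, hBC]
  calc y + (B : E →L[𝕜] E) r + (F (C y) + F r) = y + F (C y) + ((B : E →L[𝕜] E) r + F r) := by abel
    _ = y := by rw [h1]; abel

/-- If the finite sums are controlled by the `q`-sums of the norms of their terms, then so are the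
infinite ones. -/
theorem summable_and_norm_tsum_le_of_rpow [CompleteSpace E] {d : ℕ → E} {K q C : ℝ} (hq : 0 < q)
    (hK0 : 0 ≤ K) (hK : ∀ t : Finset ℕ, ‖∑ n ∈ t, d n‖ ≤ K * (∑ n ∈ t, ‖d n‖ ^ q) ^ (1 / q))
    (hs : Summable fun n => ‖d n‖ ^ q) (hC : (∑' n, ‖d n‖ ^ q) ^ (1 / q) ≤ C) :
    Summable d ∧ ‖∑' n, d n‖ ≤ K * C := by
  have h0 (n : ℕ) : 0 ≤ ‖d n‖ ^ q := by positivity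
  have hd : Summable d := by
    rw [summable_iff_vanishing_norm]
    intro ε hε
    -- K + 1 instead of K, because K may be 0.
    have hδ : 0 < (ε / (K + 1)) ^ q := by positivity
    obtain ⟨s, hs'⟩ := summable_iff_vanishing_norm.1 hs _ hδ
    refine ⟨s, fun t ht => ?_⟩
    have h1 := hs' t ht
    rw [Real.norm_eq_abs, abs_of_nonneg (Finset.sum_nonneg fun n _ => h0 n)] at h1
    have h2 : (∑ n ∈ t, ‖d n‖ ^ q) ^ (1 / q) ≤ ε / (K + 1) := by
      rw [one_div, Real.rpow_inv_le_iff_of_pos (Finset.sum_nonneg fun n _ => h0 n)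
        (by positivity) hq]
      exact h1.le
    calc _ ≤ K * (ε / (K + 1)) := (hK t).trans (by gcongr)
      _ < (K + 1) * (ε / (K + 1)) := by gcongr; linarith
      _ = ε := by field_simp
  refine ⟨hd, le_of_tendsto hd.hasSum.norm (Eventually.of_forall fun t => (hK t).trans ?_)⟩
  gcongr
  refine le_trans ?_ hC
  gcongr
  exact hs.sum_le_tsum t fun n _ => h0 n

/-- `hK` converts the q-sum bound on the P_n (J_n − P_n) into the norm bound K c for their sum. Only
n ≥ 1 enters that sum; at index 0 nothing is known to be small, and the ranks make up for it. -/
theorem isUnconditional_and_areIsomorphic_of_norm_sum_le [CompleteSpace E]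
    (h𝔐 : IsUnconditionalSchauderDecompositionWith 𝔐 M) (hP : IsCoordinateProjections 𝔐 P)
    {K q c : ℝ} (hq : 0 < q) (hK0 : 0 ≤ K) (hKc : K * c < 1) (hc : 0 ≤ c)
    (hK : ∀ (s : Finset ℕ) (y : ℕ → E), (∀ i, y i ∈ 𝔐 i) →
      ‖∑ i ∈ s, y i‖ ≤ K * (∑ i ∈ s, ‖y i‖ ^ q) ^ (1 / q))
    {m : ℕ} (hm : FiniteDimensional 𝕜 (𝔐 0)) (hm' : Module.finrank 𝕜 (𝔐 0) ≤ m)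
    {J : ℕ → E →L[𝕜] E} (hJ : ∀ n k, (J n).comp (J k) = if n = k then J n else 0)
    (hJ₀ : Module.rank 𝕜 (LinearMap.range (J 0).toLinearMap) = m)
    (hJP : ∀ x, Summable (fun n : ℕ => ‖P (n + 1) (J (n + 1) x - P (n + 1) x)‖ ^ q) ∧
      (∑' n : ℕ, ‖P (n + 1) (J (n + 1) x - P (n + 1) x)‖ ^ q) ^ (1 / q) ≤ c * ‖x‖) :
    IsUnconditionalSchauderDecomposition (fun n => LinearMap.range (J n).toLinearMap) ∧
      AreIsomorphicDecompositions 𝔐 (fun n => LinearMap.range (J n).toLinearMap) := by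
  have hS := h𝔐.toIsSchauderDecomposition
  have hJJ (n k : ℕ) (x : E) : J n (J k x) = if n = k then J n x else 0 := by
    have := congrArg (fun T : E →L[𝕜] E => T x) (hJ n k)
    simp only [ContinuousLinearMap.comp_apply] at this
    rw [this]
    split_ifs <;> rfl
  have hPP (n k : ℕ) (x : E) : P n (P k x) = if n = k then P n x else 0 := by
    rw [hP.apply_of_mem hS (hP.mem k x)]
    split_ifs with h
    · rw [h]
    · rfl
  set d : E → ℕ → E := fun x n => P (n + 1) (J (n + 1) x - P (n + 1) x) with hd
  have hdK (x : E) : Summable (d x) ∧ ‖∑' n, d x n‖ ≤ K * (c * ‖x‖) := by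
    refine summable_and_norm_tsum_le_of_rpow hq hK0 (fun t => ?_) (hJP x).1 (hJP x).2
    have := hK (t.map ⟨Nat.succ, Nat.succ_injective⟩) (fun i => P i (J i x - P i x))
      (fun i => hP.mem i _)
    rw [Finset.sum_map, Finset.sum_map] at this
    exact this
  have hPc (n : ℕ) : ∃ Q : E →L[𝕜] E, ∀ x, Q x = P n x :=
    ⟨(P n).mkContinuous M fun x => by simpa using h𝔐.norm_sum_proj_le hP {n} x, fun x => rfl⟩
  choose Q hQ using hPc
  obtain ⟨A, hA⟩ : ∃ A : E →L[𝕜] E, ∀ x, A x = ∑' n, d x n := by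
    refine ⟨LinearMap.mkContinuous ⟨⟨fun x => ∑' n, d x n, fun x y => ?_⟩, fun a x => ?_⟩ (K * c)
      fun x => ?_, fun x => rfl⟩
    · rw [← (hdK x).1.tsum_add (hdK y).1]
      congr 1
      funext n
      simp only [hd, map_add, map_sub]
      abel
    · dsimp only [RingHom.id_apply]
      rw [← (hdK x).1.tsum_const_smul]
      congr 1
      funext n
      simp only [hd, map_smul, ← smul_sub]
    · exact ((hdK x).2).trans_eq (by ring)
  have hAnorm : ‖A‖ < 1 := by
    refine lt_of_le_of_lt (A.opNorm_le_bound (mul_nonneg hK0 hc) fun x => ?_) hKc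
    rw [hA]
    exact ((hdK x).2).trans_eq (by ring)
  have hPA (k : ℕ) (x : E) : P k (A x) = if k = 0 then 0 else P k (J k x - P k x) := by
    rw [hA, ← hQ, (Q k).map_tsum (hdK x).1]
    simp only [hQ, hd, hPP]
    rcases k with _ | k
    · simp
    · rw [tsum_eq_single k (fun n hn => by simp [hn.symm])]
      simp
  have hU : IsUnit (1 + A) := by
    have := isUnit_one_sub_of_norm_lt_one (x := -A) (by rwa [norm_neg])
    rwa [sub_neg_eq_add] at this
  have hUinj {x : E} (hx : x + A x = 0) : x = 0 := by
    have := (ContinuousLinearMap.isUnit_iff_bijective.1 hU).1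
    exact this (by simpa using hx)
  set W : E →L[𝕜] E := (1 + A) + ((Q 0).comp (J 0) - Q 0) with hW
  have hWapp (x : E) : W x = x + A x + (P 0 (J 0 x) - P 0 x) := by simp [hW, hQ]
  have hPW (k : ℕ) (x : E) : P k (W x) = P k (J k x) := by
    rw [hWapp]
    simp only [map_add, map_sub, hPA, hPP]
    rcases k with _ | k
    · simp
    · simp
  have hWJ (n : ℕ) (x : E) : W (J n x) = P n (W x) := by
    refine hP.ext fun k => ?_
    rw [hPW, hPW, hJJ, hPP]
    split_ifs with h
    · rw [h]
    · simp
  -- N = ker (1 + A − P_0) contains the range of J_0, as comparing coordinates shows. On N, P_0 x =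
  -- 0 forces x + A x = 0 and x = 0, so P_0 embeds N into 𝔐_0 and dim N ≤ m. Equality of dimensions
  -- gives N = range J_0.
  have hker : ∀ x, x + A x = P 0 x → x ∈ LinearMap.range (J 0).toLinearMap := by
    let N : Submodule 𝕜 E := LinearMap.ker ((1 + A - Q 0 : E →L[𝕜] E) : E →ₗ[𝕜] E)
    have hN (x : E) : x ∈ N ↔ x + A x = P 0 x := by
      simp [N, LinearMap.mem_ker, sub_eq_zero, hQ]
    have hJN : LinearMap.range (J 0).toLinearMap ≤ N := by
      rintro _ ⟨x, rfl⟩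
      rw [hN]
      refine hP.ext fun k => ?_
      change P k (J 0 x + A (J 0 x)) = P k (P 0 (J 0 x))
      rw [map_add, hPA, hPP]
      rcases k with _ | k
      · simp
      · simp [hJJ, hPP]
    let f : N →ₗ[𝕜] 𝔐 0 := (P 0 ∘ₗ N.subtype).codRestrict (𝔐 0) fun x => hP.mem 0 x
    have hf : Function.Injective f := by
      rw [injective_iff_map_eq_zero]
      intro x hx
      have h1 : P 0 (x : E) = 0 := congrArg Subtype.val hx
      exact Subtype.ext (hUinj (((hN x).1 x.2).trans h1))
    have : FiniteDimensional 𝕜 N := FiniteDimensional.of_injective f hf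
    have hle : Module.finrank 𝕜 N ≤ m := (LinearMap.finrank_le_finrank_of_injective hf).trans hm'
    have heq := Submodule.eq_of_le_of_finrank_le hJN
      (hle.trans_eq (Module.finrank_eq_of_rank_eq hJ₀).symm)
    intro x hx
    rw [heq]
    exact (hN x).2 hx
  -- If W x = 0, all P_k J_k x vanish, so x + A x = P_0 x and x = J_0 x by `hker`. Then P_0 x = P_0
  -- J_0 x = 0, and injectivity of 1 + A ends the argument.
  have hWinj : Function.Injective W := by
    rw [injective_iff_map_eq_zero]
    intro x hx
    have hk (k : ℕ) : P k (J k x) = 0 := by rw [← hPW, hx, map_zero]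
    have h1 : x + A x = P 0 x := by
      have := hWapp x
      rw [hx, hk 0, zero_sub, ← sub_eq_add_neg] at this
      exact sub_eq_zero.1 this.symm
    obtain ⟨z, hz⟩ := hker x h1
    have h2 : J 0 x = x := by
      have hz' : J 0 z = x := hz
      rw [← hz', hJJ, if_pos rfl]
    refine hUinj (h1.trans ?_)
    rw [← h2]
    exact hk 0
  have hWsurj : Function.Surjective W :=
    surjective_of_injective_of_finiteRank hU (R := 𝔐 0)
      (fun x => by
        simp only [sub_apply, ContinuousLinearMap.comp_apply, hQ]
        exact sub_mem (hP.mem 0 _) (hP.mem 0 _)) hWinj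
  let T : E ≃L[𝕜] E := ContinuousLinearEquiv.ofBijective W (LinearMap.ker_eq_bot.2 hWinj)
    (LinearMap.range_eq_top.2 hWsurj)
  have hT (x : E) : T x = W x := rfl
  have hrange (n : ℕ) : LinearMap.range (J n).toLinearMap =
      (𝔐 n).map (T.symm : E →ₗ[𝕜] E) := by
    ext x
    constructor
    · rintro ⟨z, rfl⟩
      refine ⟨W (J n z), ?_, ?_⟩
      · rw [hWJ]
        exact hP.mem n _
      · rw [← hT]
        exact T.symm_apply_apply _
    · rintro ⟨y, hy, rfl⟩
      refine ⟨T.symm y, T.injective ?_⟩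
      change T (J n (T.symm y)) = T (T.symm y)
      rw [hT, hWJ, ← hT, T.apply_symm_apply, hP.apply_of_mem hS hy, if_pos rfl]
  have hfun : (fun n => LinearMap.range (J n).toLinearMap) =
      fun n => (𝔐 n).map (T.symm : E →ₗ[𝕜] E) := funext hrange
  refine ⟨?_, T.symm, hrange⟩
  rw [hfun]
  exact (h𝔐.isUnconditional hP).map T.symm

end Abstract

/-! ### Numerical bounds for the tails of |cos u|^s / u³. -/

theorem setIntegral_Ioi_le_of_hasDerivAt {Ψ Ψ' g : ℝ → ℝ} {c L : ℝ}
    (hd : ∀ u ∈ Ici c, HasDerivAt Ψ (Ψ' u) u) (hg0 : ∀ u ∈ Ioi c, 0 ≤ g u)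
    (hg : ∀ u ∈ Ioi c, g u ≤ Ψ' u) (hL : Tendsto Ψ atTop (𝓝 L)) :
    ∫ u in Ioi c, g u ≤ L - Ψ c := by
  have h0 : ∀ u ∈ Ioi c, 0 ≤ Ψ' u := fun u hu => (hg0 u hu).trans (hg u hu)
  rw [← integral_Ioi_of_hasDerivAt_of_nonneg' hd h0 hL]
  refine integral_mono_of_nonneg ?_ (integrableOn_Ioi_deriv_of_nonneg' hd h0 hL) ?_
  · exact (ae_restrict_iff' measurableSet_Ioi).2 (Eventually.of_forall hg0)
  · exact (ae_restrict_iff' measurableSet_Ioi).2 (Eventually.of_forall hg)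

theorem tendsto_bounded_div_pow_atTop {f : ℝ → ℝ} {C : ℝ} (hf : ∀ u, |f u| ≤ C) {n : ℕ}
    (hn : n ≠ 0) : Tendsto (fun u : ℝ => f u / u ^ n) atTop (𝓝 0) := by
  have h1 : Tendsto (fun u : ℝ => C / u ^ n) atTop (𝓝 0) :=
    tendsto_const_nhds.div_atTop (tendsto_pow_atTop hn)
  refine squeeze_zero_norm' ?_ h1
  filter_upwards [eventually_gt_atTop 0] with u hu
  rw [Real.norm_eq_abs, abs_div, abs_of_pos (pow_pos hu n)]
  gcongr
  exact hf u

theorem setIntegral_cos_sq_tail :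
    ∫ u in Ioi (3 * π / 2), cos u ^ 2 / u ^ 3 ≤ 1 / (9 * π ^ 2) := by
  have hpi := Real.pi_pos
  -- Ψ comes from integrating (1 + cos 2u) / (2u³) by parts twice. The constant added to cos 2u
  -- makes the remainder nonnegative and the u⁻⁴ term vanish at 3π/2.
  have key := setIntegral_Ioi_le_of_hasDerivAt (c := 3 * π / 2) (L := 0)
    (g := fun u => cos u ^ 2 / u ^ 3)
    (Ψ := fun u => (-1 / 4) / u ^ 2 + (sin (2 * u) / 4) / u ^ 3
      + (-(3 / 8) * (1 + cos (2 * u))) / u ^ 4)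
    (Ψ' := fun u => cos u ^ 2 / u ^ 3 + 3 / 2 * (1 + cos (2 * u)) / u ^ 5) ?_ ?_ ?_ ?_
  · refine key.trans (le_of_eq ?_)
    have h1 : sin (2 * (3 * π / 2)) = 0 := by
      rw [show 2 * (3 * π / 2) = (3 : ℕ) * π by push_cast; ring]; exact Real.sin_nat_mul_pi 3
    have h2 : cos (2 * (3 * π / 2)) = -1 := by
      rw [show 2 * (3 * π / 2) = π + (1 : ℕ) * (2 * π) by push_cast; ring,
        Real.cos_add_nat_mul_two_pi, Real.cos_pi]
    simp only [h1, h2]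
    field_simp
    norm_num
    ring
  · intro u hu
    have hu0 : u ≠ 0 := by
      have : 0 < u := lt_of_lt_of_le (by positivity) hu
      exact this.ne'
    have hs : HasDerivAt (fun u : ℝ => sin (2 * u)) (cos (2 * u) * 2) u := by
      simpa using (((hasDerivAt_id u).const_mul (2 : ℝ))).sin
    have hc : HasDerivAt (fun u : ℝ => cos (2 * u)) (-sin (2 * u) * 2) u := by
      simpa using (((hasDerivAt_id u).const_mul (2 : ℝ))).cos
    have := (((hasDerivAt_const u (-1 / 4 : ℝ)).div (hasDerivAt_pow 2 u) (pow_ne_zero 2 hu0)).add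
      ((hs.div_const 4).div (hasDerivAt_pow 3 u) (pow_ne_zero 3 hu0))).add
      (((hc.const_add 1).const_mul (-(3 / 8))).div (hasDerivAt_pow 4 u) (pow_ne_zero 4 hu0))
    refine this.congr_deriv ?_
    rw [Real.cos_sq u]
    field_simp
    push_cast
    ring
  · intro u hu
    have : 0 < u := lt_trans (by positivity) hu
    positivity
  · intro u hu
    have : 0 < u := lt_trans (by positivity) hu
    have h1 := Real.neg_one_le_cos (2 * u)
    have : 0 ≤ 3 / 2 * (1 + cos (2 * u)) / u ^ 5 :=
      div_nonneg (by linarith) (by positivity)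
    linarith
  · have e1 := tendsto_bounded_div_pow_atTop (f := fun _ => (-1 / 4 : ℝ)) (C := 1)
      (by intro u; norm_num [abs_le]) (n := 2) (by norm_num)
    have e2 := tendsto_bounded_div_pow_atTop (f := fun u => sin (2 * u) / 4) (C := 1)
      (by intro u; rw [abs_le]; constructor <;> nlinarith [Real.neg_one_le_sin (2 * u), Real.sin_le_one (2 * u)]) (n := 3) (by norm_num)
    have e3 := tendsto_bounded_div_pow_atTop (f := fun u => -(3 / 8) * (1 + cos (2 * u))) (C := 1)
      (by intro u; rw [abs_le]; constructor <;> nlinarith [Real.neg_one_le_cos (2 * u), Real.cos_le_one (2 * u)]) (n := 4) (by norm_num)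
    simpa using (e1.add e2).add e3

/-- With y = |cos u| the gap is (2y − 1)² (1 − y) (y + 2) / 9. A trigonometric polynomial can be
integrated by parts where |cos u| cannot. -/
theorem abs_cos_le_trig_poly (u : ℝ) :
    |cos u| ≤ 2 / 3 + 7 / 18 * cos (2 * u) - 1 / 18 * cos (4 * u) := by
  have h4 : cos (4 * u) = 2 * cos (2 * u) ^ 2 - 1 := by
    rw [show 4 * u = 2 * (2 * u) by ring, Real.cos_two_mul]
  have h2 : cos (2 * u) = 2 * |cos u| ^ 2 - 1 := by rw [sq_abs, Real.cos_two_mul]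
  rw [h4, h2]
  have h0 := abs_nonneg (cos u)
  have h1 := Real.abs_cos_le_one u
  set y := |cos u|
  have : 0 ≤ (2 * y - 1) ^ 2 * ((1 - y) * (y + 2)) := by
    apply mul_nonneg (sq_nonneg _) (mul_nonneg _ _) <;> linarith
  nlinarith

theorem setIntegral_abs_cos_tail :
    ∫ u in Ioi (3 * π / 2), |cos u| / u ^ 3 ≤ 4 / (27 * π ^ 2) := by
  have hpi := Real.pi_pos
  -- Again two integrations by parts, now of the majorant; 29/288 makes the remainder nonnegative
  -- and the u⁻⁴ term vanish at 3π/2.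
  have key := setIntegral_Ioi_le_of_hasDerivAt (c := 3 * π / 2) (L := 0)
    (g := fun u => |cos u| / u ^ 3)
    (Ψ := fun u => (-1 / 3) / u ^ 2 + (7 / 36 * sin (2 * u) - 1 / 72 * sin (4 * u)) / u ^ 3
      + (3 * (-(7 / 72) * cos (2 * u) + 1 / 288 * cos (4 * u) - 29 / 288)) / u ^ 4)
    (Ψ' := fun u => (2 / 3 + 7 / 18 * cos (2 * u) - 1 / 18 * cos (4 * u)) / u ^ 3
      + 12 * (7 / 72 * cos (2 * u) - 1 / 288 * cos (4 * u) + 29 / 288) / u ^ 5) ?_ ?_ ?_ ?_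
  · refine key.trans (le_of_eq ?_)
    have h1 : sin (2 * (3 * π / 2)) = 0 := by
      rw [show 2 * (3 * π / 2) = (3 : ℕ) * π by push_cast; ring]; exact Real.sin_nat_mul_pi 3
    have h2 : cos (2 * (3 * π / 2)) = -1 := by
      rw [show 2 * (3 * π / 2) = π + (1 : ℕ) * (2 * π) by push_cast; ring,
        Real.cos_add_nat_mul_two_pi, Real.cos_pi]
    have h3 : sin (4 * (3 * π / 2)) = 0 := by
      rw [show 4 * (3 * π / 2) = (6 : ℕ) * π by push_cast; ring]; exact Real.sin_nat_mul_pi 6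
    have h4 : cos (4 * (3 * π / 2)) = 1 := by
      rw [show 4 * (3 * π / 2) = (3 : ℕ) * (2 * π) by push_cast; ring,
        Real.cos_nat_mul_two_pi]
    simp only [h1, h2, h3, h4]
    field_simp
    norm_num
    ring
  · intro u hu
    have hu0 : u ≠ 0 := by
      have : 0 < u := lt_of_lt_of_le (by positivity) hu
      exact this.ne'
    have hs (k : ℝ) : HasDerivAt (fun u : ℝ => sin (k * u)) (cos (k * u) * k) u := by
      simpa using (((hasDerivAt_id u).const_mul k)).sin
    have hc (k : ℝ) : HasDerivAt (fun u : ℝ => cos (k * u)) (-sin (k * u) * k) u := by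
      simpa using (((hasDerivAt_id u).const_mul k)).cos
    have := (((hasDerivAt_const u (-1 / 3 : ℝ)).div (hasDerivAt_pow 2 u) (pow_ne_zero 2 hu0)).add
      ((((hs 2).const_mul (7 / 36)).sub ((hs 4).const_mul (1 / 72))).div
        (hasDerivAt_pow 3 u) (pow_ne_zero 3 hu0))).add
      ((((((hc 2).const_mul (-(7 / 72))).add ((hc 4).const_mul (1 / 288))).sub_const
        (29 / 288)).const_mul 3).div (hasDerivAt_pow 4 u) (pow_ne_zero 4 hu0))
    refine this.congr_deriv ?_
    simp only [Pi.add_apply, Pi.sub_apply]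
    field_simp
    push_cast
    ring
  · intro u hu
    have : 0 < u := lt_trans (by positivity) hu
    positivity
  · intro u hu
    have hu0 : 0 < u := lt_trans (by positivity) hu
    have h4 : cos (4 * u) = 2 * cos (2 * u) ^ 2 - 1 := by
      rw [show 4 * u = 2 * (2 * u) by ring, Real.cos_two_mul]
    have h1 := Real.neg_one_le_cos (2 * u)
    have h1' := Real.cos_le_one (2 * u)
    have : 0 ≤ 12 * (7 / 72 * cos (2 * u) - 1 / 288 * cos (4 * u) + 29 / 288) / u ^ 5 := by
      refine div_nonneg ?_ (by positivity)
      rw [h4]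
      nlinarith
    have h5 : |cos u| / u ^ 3 ≤ (2 / 3 + 7 / 18 * cos (2 * u) - 1 / 18 * cos (4 * u)) / u ^ 3 := by
      gcongr
      exact abs_cos_le_trig_poly u
    linarith
  · have e1 := tendsto_bounded_div_pow_atTop (f := fun _ => (-1 / 3 : ℝ)) (C := 1)
      (by intro u; norm_num [abs_le]) (n := 2) (by norm_num)
    have e2 := tendsto_bounded_div_pow_atTop
      (f := fun u => 7 / 36 * sin (2 * u) - 1 / 72 * sin (4 * u)) (C := 1)
      (by intro u; rw [abs_le]; constructor <;> nlinarith [Real.neg_one_le_sin (2 * u), Real.sin_le_one (2 * u), Real.neg_one_le_sin (4 * u), Real.sin_le_one (4 * u)]) (n := 3) (by norm_num)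
    have e3 := tendsto_bounded_div_pow_atTop
      (f := fun u => 3 * (-(7 / 72) * cos (2 * u) + 1 / 288 * cos (4 * u) - 29 / 288)) (C := 1)
      (by intro u; rw [abs_le]; constructor <;> nlinarith [Real.neg_one_le_cos (2 * u), Real.cos_le_one (2 * u), Real.neg_one_le_cos (4 * u), Real.cos_le_one (4 * u)]) (n := 4) (by norm_num)
    simpa using (e1.add e2).add e3

/-- The even part of `u ↦ (π + u)⁻³`, bounded by a polynomial. -/
theorem inv_cube_add_inv_cube_le {x : ℝ} (hx0 : 0 ≤ x) (hx : x ≤ π / 2) :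
    1 / (π - x) ^ 3 + 1 / (π + x) ^ 3 ≤
      2 / π ^ 3 * (1 + 6 / π ^ 2 * x ^ 2 + 15 / π ^ 4 * x ^ 4 + 28 / π ^ 6 * x ^ 6
        + 70 / π ^ 8 * x ^ 8) := by
  have hpi := Real.pi_pos
  obtain ⟨y, rfl⟩ : ∃ y, x = π * y := ⟨x / π, by field_simp⟩
  have hy0 : 0 ≤ y := by by_contra h; push Not at h; nlinarith
  have hy : y ≤ 1 / 2 := by by_contra h; push Not at h; nlinarith
  have e1 : 1 / (π - π * y) ^ 3 + 1 / (π + π * y) ^ 3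
      = 2 / π ^ 3 * ((1 + 3 * y ^ 2) / (1 - y ^ 2) ^ 3) := by
    have h1 : 1 - y ≠ 0 := by linarith
    have h2 : 1 + y ≠ 0 := by linarith
    rw [show π - π * y = π * (1 - y) by ring, show π + π * y = π * (1 + y) by ring,
      show 1 - y ^ 2 = (1 - y) * (1 + y) by ring]
    field_simp
    ring
  have e2 : 1 + 6 / π ^ 2 * (π * y) ^ 2 + 15 / π ^ 4 * (π * y) ^ 4
      + 28 / π ^ 6 * (π * y) ^ 6 + 70 / π ^ 8 * (π * y) ^ 8
      = 1 + 6 * y ^ 2 + 15 * (y ^ 2) ^ 2 + 28 * (y ^ 2) ^ 3 + 70 * (y ^ 2) ^ 4 := by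
    field_simp
  rw [e1, e2]
  have hz0 : 0 ≤ y ^ 2 := sq_nonneg y
  have hz : y ^ 2 ≤ 1 / 4 := by nlinarith
  generalize y ^ 2 = z at hz0 hz
  gcongr
  rw [div_le_iff₀ (by have : 0 < 1 - z := by linarith
                      positivity)]
  -- The series of (1 + 3z) / (1 − z)³ begins 1, 6, 15, 28, 45; raising 45 to 70 absorbs all later
  -- terms for z ≤ 1/4.
  have : 0 ≤ z ^ 4 * (25 - 141 * z + 182 * z ^ 2 - 70 * z ^ 3) := by
    apply mul_nonneg (by positivity)
    have h1 : 0 ≤ (1 / 4 - z) * (799 / 8 - 329 / 2 * z + 70 * z ^ 2) :=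
      mul_nonneg (by linarith) (by nlinarith)
    nlinarith
  nlinarith

/-- Folding [π/2, 3π/2] about π pairs the weights (π − x)⁻³ and (π + x)⁻³, whose sum has a
polynomial majorant. -/
theorem intervalIntegral_div_cube_le {v w : ℝ → ℝ} (hw : Continuous w)
    (hv1 : ∀ x, w (π - x) = v x) (hv2 : ∀ x, w (π + x) = v x) (hv0 : ∀ x, 0 ≤ v x) :
    ∫ u in (π / 2)..(3 * π / 2), w u / u ^ 3 ≤ ∫ x in (0 : ℝ)..(π / 2), v x *
      (2 / π ^ 3 * (1 + 6 / π ^ 2 * x ^ 2 + 15 / π ^ 4 * x ^ 4 + 28 / π ^ 6 * x ^ 6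
        + 70 / π ^ 8 * x ^ 8)) := by
  have hpi := Real.pi_pos
  have hcv : Continuous v := by
    have : v = fun x => w (π + x) := funext fun x => (hv2 x).symm
    rw [this]; fun_prop
  have hint (a b : ℝ) (ha : 0 < a) (hb : 0 < b) :
      IntervalIntegrable (fun u => w u / u ^ 3) volume a b := by
    apply ContinuousOn.intervalIntegrable
    intro u hu
    have : u ≠ 0 := by
      have := hu.1
      have : 0 < min a b := lt_min ha hb
      exact (lt_of_lt_of_le this hu.1).ne'
    exact (hw.continuousAt.div (continuousAt_id.pow 3) (pow_ne_zero 3 this)).continuousWithinAt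
  rw [← intervalIntegral.integral_add_adjacent_intervals (hint (π / 2) π (by positivity) hpi)
    (hint π (3 * π / 2) hpi (by positivity))]
  have e1 : ∫ u in (π / 2)..π, w u / u ^ 3 = ∫ x in (0 : ℝ)..(π / 2), v x / (π - x) ^ 3 := by
    have := intervalIntegral.integral_comp_sub_left (a := 0) (b := π / 2)
      (fun u => w u / u ^ 3) π
    rw [show π - π / 2 = π / 2 by ring, sub_zero] at this
    rw [← this]
    simp only [hv1]
  have e2 : ∫ u in π..(3 * π / 2), w u / u ^ 3 = ∫ x in (0 : ℝ)..(π / 2), v x / (π + x) ^ 3 := by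
    have := intervalIntegral.integral_comp_add_left (a := 0) (b := π / 2)
      (fun u => w u / u ^ 3) π
    rw [show π + π / 2 = 3 * π / 2 by ring, add_zero] at this
    rw [← this]
    simp only [hv2]
  have h1 : ContinuousOn (fun x => v x / (π - x) ^ 3) (uIcc 0 (π / 2)) := by
    refine hcv.continuousOn.div (by fun_prop) fun x hx => ?_
    rw [uIcc_of_le (by positivity)] at hx
    have : 0 < π - x := by linarith [hx.2]
    positivity
  have h2 : ContinuousOn (fun x => v x / (π + x) ^ 3) (uIcc 0 (π / 2)) := by
    refine hcv.continuousOn.div (by fun_prop) fun x hx => ?_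
    rw [uIcc_of_le (by positivity)] at hx
    have : 0 < π + x := by linarith [hx.1]
    positivity
  rw [e1, e2, ← intervalIntegral.integral_add h1.intervalIntegrable h2.intervalIntegrable]
  refine intervalIntegral.integral_mono_on (by positivity) (h1.add h2).intervalIntegrable
    (by apply Continuous.intervalIntegrable; fun_prop) fun x hx => ?_
  have := mul_le_mul_of_nonneg_left (inv_cube_add_inv_cube_le hx.1 hx.2) (hv0 x)
  refine le_trans (le_of_eq ?_) this
  ring

/-- The closed forms below are polynomials in 1/π² with large coefficients of alternating sign (up
to 2822400), hence the many digits. -/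
theorem inv_pi_sq_bounds : 0.1013211836423 ≤ 1 / π ^ 2 ∧ 1 / π ^ 2 ≤ 0.1013211836424 ∧
    2 / π ^ 3 ≤ 0.064504 := by
  have hpi := Real.pi_pos
  have hl := pow_le_pow_left₀ (by norm_num) Real.pi_gt_d20.le 2
  have hu := pow_le_pow_left₀ hpi.le Real.pi_lt_d20.le 2
  have hl3 := pow_le_pow_left₀ (by norm_num) Real.pi_gt_d20.le 3
  refine ⟨?_, ?_, ?_⟩
  · rw [le_div_iff₀ (by positivity)]
    norm_num at hu ⊢
    linarith
  · rw [div_le_iff₀ (by positivity)]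
    norm_num at hl ⊢
    linarith
  · rw [div_le_iff₀ (by positivity)]
    norm_num at hl3 ⊢
    linarith

theorem intervalIntegral_abs_cos_le :
    ∫ u in (π / 2)..(3 * π / 2), |cos u| / u ^ 3 ≤ 893 / 10000 := by
  have hpi := Real.pi_pos
  refine (intervalIntegral_div_cube_le (v := fun x => |cos x|) (w := fun u => |cos u|)
    (by fun_prop) (by simp [Real.cos_pi_sub]) (by simp [Real.cos_add]) (by simp)).trans ?_
  -- Let Q = ∑ c_k x^k. Then Q sin + Q' cos is an antiderivative of (Q + Q'') cos, and the c_k solve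
  -- Q + Q'' = polynomial weight from the top degree down.
  obtain ⟨c8, h8⟩ : ∃ c8 : ℝ, c8 = 70 / π ^ 8 := ⟨_, rfl⟩
  obtain ⟨c6, h6⟩ : ∃ c6 : ℝ, c6 = 28 / π ^ 6 - 56 * c8 := ⟨_, rfl⟩
  obtain ⟨c4, h4⟩ : ∃ c4 : ℝ, c4 = 15 / π ^ 4 - 30 * c6 := ⟨_, rfl⟩
  obtain ⟨c2, h2⟩ : ∃ c2 : ℝ, c2 = 6 / π ^ 2 - 12 * c4 := ⟨_, rfl⟩
  obtain ⟨c0, h0⟩ : ∃ c0 : ℝ, c0 = 1 - 2 * c2 := ⟨_, rfl⟩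
  have hd (x : ℝ) : HasDerivAt (fun x : ℝ => 2 / π ^ 3 *
      ((c0 + c2 * x ^ 2 + c4 * x ^ 4 + c6 * x ^ 6 + c8 * x ^ 8) * sin x
      + (2 * c2 * x + 4 * c4 * x ^ 3 + 6 * c6 * x ^ 5 + 8 * c8 * x ^ 7) * cos x))
      (cos x * (2 / π ^ 3 * (1 + 6 / π ^ 2 * x ^ 2 + 15 / π ^ 4 * x ^ 4 + 28 / π ^ 6 * x ^ 6
        + 70 / π ^ 8 * x ^ 8))) x := by
    have hp (c : ℝ) (n : ℕ) := (hasDerivAt_pow n x).const_mul c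
    have := ((((((hp c2 2).const_add c0).add (hp c4 4)).add (hp c6 6)).add (hp c8 8)).mul
      (Real.hasDerivAt_sin x)).add ((((((hasDerivAt_id x).const_mul (2 * c2)).add
        (hp (4 * c4) 3)).add (hp (6 * c6) 5)).add (hp (8 * c8) 7)).mul (Real.hasDerivAt_cos x))
    refine (this.const_mul (2 / π ^ 3)).congr_deriv ?_
    simp only [Pi.add_apply, id]
    rw [show 6 / π ^ 2 = c2 + 12 * c4 by linarith, show 15 / π ^ 4 = c4 + 30 * c6 by linarith,
      show 28 / π ^ 6 = c6 + 56 * c8 by linarith, ← h8, h0]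
    push_cast
    ring
  have e : ∫ x in (0 : ℝ)..(π / 2), |cos x| * (2 / π ^ 3 * (1 + 6 / π ^ 2 * x ^ 2
      + 15 / π ^ 4 * x ^ 4 + 28 / π ^ 6 * x ^ 6 + 70 / π ^ 8 * x ^ 8))
      = ∫ x in (0 : ℝ)..(π / 2), cos x * (2 / π ^ 3 * (1 + 6 / π ^ 2 * x ^ 2
      + 15 / π ^ 4 * x ^ 4 + 28 / π ^ 6 * x ^ 6 + 70 / π ^ 8 * x ^ 8)) := by
    refine intervalIntegral.integral_congr fun x hx => ?_
    rw [uIcc_of_le (by positivity)] at hx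
    show |cos x| * _ = _
    rw [abs_of_nonneg (Real.cos_nonneg_of_mem_Icc ⟨by linarith [hx.1], hx.2⟩)]
  rw [e, intervalIntegral.integral_eq_sub_of_hasDerivAt (fun x _ => hd x)
    (by apply Continuous.intervalIntegrable; fun_prop)]
  simp only [Real.sin_pi_div_two, Real.cos_pi_div_two, Real.sin_zero, Real.cos_zero]
  rw [h0, h2, h4, h6, h8]
  obtain ⟨hj1, hj2, hk⟩ := inv_pi_sq_bounds
  obtain ⟨j, hj⟩ : ∃ j : ℝ, j = 1 / π ^ 2 := ⟨_, rfl⟩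
  rw [← hj] at hj1 hj2
  have p2 := pow_le_pow_left₀ (hj ▸ by positivity) hj2 2
  have p3 := pow_le_pow_left₀ (by norm_num) hj1 3
  have p4 := pow_le_pow_left₀ (hj ▸ by positivity) hj2 4
  have hP : 1062 / 256 - 683 / 4 * j + 10230 * j ^ 2 - 372960 * j ^ 3 + 2822400 * j ^ 4
      ≤ 13842 / 10000 := by
    norm_num at p2 p3 p4 ⊢
    linarith
  have h3 : 0 ≤ 2 / π ^ 3 := by positivity
  calc _ = 2 / π ^ 3 * (1062 / 256 - 683 / 4 * j + 10230 * j ^ 2 - 372960 * j ^ 3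
        + 2822400 * j ^ 4) := by
        rw [hj]
        field_simp
        ring
    _ ≤ 2 / π ^ 3 * (13842 / 10000) := by gcongr
    _ ≤ _ := by linarith

theorem intervalIntegral_cos_sq_le :
    ∫ u in (π / 2)..(3 * π / 2), cos u ^ 2 / u ^ 3 ≤ 6309 / 100000 := by
  have hpi := Real.pi_pos
  refine (intervalIntegral_div_cube_le (v := fun x => cos x ^ 2) (w := fun u => cos u ^ 2)
    (by fun_prop) (by simp [Real.cos_pi_sub]) (by simp [Real.cos_add])
    (fun x => sq_nonneg _)).trans ?_
  -- After cos² x = (1 + cos 2x) / 2 the equation is 2Q + Q''/2 = polynomial weight, with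
  -- antiderivative Q sin 2x + (Q'/2) cos 2x for the oscillating part.
  obtain ⟨c8, h8⟩ : ∃ c8 : ℝ, c8 = 70 / π ^ 8 / 2 := ⟨_, rfl⟩
  obtain ⟨c6, h6⟩ : ∃ c6 : ℝ, c6 = 28 / π ^ 6 / 2 - 14 * c8 := ⟨_, rfl⟩
  obtain ⟨c4, h4⟩ : ∃ c4 : ℝ, c4 = 15 / π ^ 4 / 2 - 15 / 2 * c6 := ⟨_, rfl⟩
  obtain ⟨c2, h2⟩ : ∃ c2 : ℝ, c2 = 6 / π ^ 2 / 2 - 3 * c4 := ⟨_, rfl⟩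
  obtain ⟨c0, h0⟩ : ∃ c0 : ℝ, c0 = 1 / 2 - c2 / 2 := ⟨_, rfl⟩
  have hd (x : ℝ) : HasDerivAt (fun x : ℝ => 1 / π ^ 3 *
      ((c0 + c2 * x ^ 2 + c4 * x ^ 4 + c6 * x ^ 6 + c8 * x ^ 8) * sin (2 * x)
      + (c2 * x + 2 * c4 * x ^ 3 + 3 * c6 * x ^ 5 + 4 * c8 * x ^ 7) * cos (2 * x)
      + (x + 6 / π ^ 2 / 3 * x ^ 3 + 15 / π ^ 4 / 5 * x ^ 5 + 28 / π ^ 6 / 7 * x ^ 7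
        + 70 / π ^ 8 / 9 * x ^ 9)))
      (cos x ^ 2 * (2 / π ^ 3 * (1 + 6 / π ^ 2 * x ^ 2 + 15 / π ^ 4 * x ^ 4 + 28 / π ^ 6 * x ^ 6
        + 70 / π ^ 8 * x ^ 8))) x := by
    have hp (c : ℝ) (n : ℕ) := (hasDerivAt_pow n x).const_mul c
    have hs : HasDerivAt (fun u : ℝ => sin (2 * u)) (cos (2 * x) * 2) x := by
      simpa using (((hasDerivAt_id x).const_mul (2 : ℝ))).sin
    have hc : HasDerivAt (fun u : ℝ => cos (2 * u)) (-sin (2 * x) * 2) x := by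
      simpa using (((hasDerivAt_id x).const_mul (2 : ℝ))).cos
    have := (((((((hp c2 2).const_add c0).add (hp c4 4)).add (hp c6 6)).add (hp c8 8)).mul
      hs).add ((((((hasDerivAt_id x).const_mul c2).add
        (hp (2 * c4) 3)).add (hp (3 * c6) 5)).add (hp (4 * c8) 7)).mul hc)).add
        (((((hasDerivAt_id x).add (hp (6 / π ^ 2 / 3) 3)).add (hp (15 / π ^ 4 / 5) 5)).add
          (hp (28 / π ^ 6 / 7) 7)).add (hp (70 / π ^ 8 / 9) 9))
    refine (this.const_mul (1 / π ^ 3)).congr_deriv ?_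
    simp only [Pi.add_apply, id]
    rw [Real.cos_sq x, show 6 / π ^ 2 = 2 * c2 + 6 * c4 by linarith,
      show 15 / π ^ 4 = 2 * c4 + 15 * c6 by linarith,
      show 28 / π ^ 6 = 2 * c6 + 28 * c8 by linarith, show 70 / π ^ 8 = 2 * c8 by linarith, h0]
    push_cast
    ring
  rw [intervalIntegral.integral_eq_sub_of_hasDerivAt (fun x _ => hd x)
    (by apply Continuous.intervalIntegrable; fun_prop)]
  simp only [show 2 * (π / 2) = π by ring, Real.sin_pi, Real.cos_pi, mul_zero, Real.sin_zero,
    Real.cos_zero]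
  rw [h2, h4, h6, h8]
  obtain ⟨hj1, hj2, hk⟩ := inv_pi_sq_bounds
  obtain ⟨j, hj⟩ : ∃ j : ℝ, j = 1 / π ^ 2 := ⟨_, rfl⟩
  rw [← hj] at hj1 hj2
  have p2 := pow_le_pow_left₀ (hj ▸ by positivity) hj2 2
  have p3 := pow_le_pow_left₀ (by norm_num) hj1 3
  have p4 := pow_le_pow_left₀ (hj ▸ by positivity) hj2 4
  have hP : 7 / 8 + 70 / 4608 - 185 / 32 * j + 1335 / 16 * j ^ 2 - 4305 / 4 * j ^ 3
      + 11025 / 2 * j ^ 4 ≤ 6226 / 10000 := by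
    norm_num at p2 p3 p4 ⊢
    linarith
  have h3 : 0 ≤ 1 / π ^ 2 := by positivity
  calc _ = 1 / π ^ 2 * (7 / 8 + 70 / 4608 - 185 / 32 * j + 1335 / 16 * j ^ 2 - 4305 / 4 * j ^ 3
      + 11025 / 2 * j ^ 4) := by
        rw [hj]
        field_simp
        ring
    _ ≤ 1 / π ^ 2 * (6226 / 10000) := by gcongr
    _ ≤ _ := by rw [← hj]; norm_num at hj2 ⊢; linarith

theorem setIntegral_Ioi_add {f : ℝ → ℝ} {a b : ℝ} (hab : a ≤ b) (hf : IntegrableOn f (Ioi a)) :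
    ∫ u in Ioi a, f u = (∫ u in a..b, f u) + ∫ u in Ioi b, f u := by
  rw [intervalIntegral.integral_of_le hab, ← setIntegral_union _ measurableSet_Ioi
    (hf.mono_set Ioc_subset_Ioi_self) (hf.mono_set (Ioi_subset_Ioi hab)), Ioc_union_Ioi_eq_Ioi hab]
  exact Set.disjoint_left.2 fun x hx hx' => absurd hx.2 (not_le.2 hx')

theorem integrableOn_Ioi_div_pow {f : ℝ → ℝ} (hf : Measurable f) {C : ℝ} (hC : ∀ u, |f u| ≤ C)
    {c : ℝ} (hc : 0 < c) : IntegrableOn (fun u => f u / u ^ 3) (Ioi c) := by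
  have h := (integrableOn_Ioi_rpow_of_lt (a := -3) (by norm_num) hc).const_mul C
  refine Integrable.mono' h (hf.div (measurable_id.pow_const 3)).aestronglyMeasurable ?_
  refine (ae_restrict_iff' measurableSet_Ioi).2 (Eventually.of_forall fun u hu => ?_)
  have hu0 : 0 < u := hc.trans hu
  rw [Real.norm_eq_abs, abs_div, abs_of_pos (pow_pos hu0 3), Real.rpow_neg hu0.le]
  norm_cast
  rw [div_eq_mul_inv]
  gcongr
  exact hC u

theorem setIntegral_abs_cos_le : ∫ u in Ioi (π / 2), |cos u| / u ^ 3 ≤ 10432 / 100000 := by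
  have hpi := Real.pi_pos
  rw [setIntegral_Ioi_add (b := 3 * π / 2) (by linarith) (integrableOn_Ioi_div_pow
    (by fun_prop) (C := 1) (fun u => by simpa using Real.abs_cos_le_one u) (by positivity))]
  have h1 := intervalIntegral_abs_cos_le
  have h2 := setIntegral_abs_cos_tail
  have h3 : 4 / (27 * π ^ 2) = 4 / 27 * (1 / π ^ 2) := by field_simp
  have h4 := inv_pi_sq_bounds.2.1
  rw [h3] at h2
  linarith

theorem setIntegral_cos_sq_le : ∫ u in Ioi (π / 2), cos u ^ 2 / u ^ 3 ≤ 7436 / 100000 := by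
  have hpi := Real.pi_pos
  rw [setIntegral_Ioi_add (b := 3 * π / 2) (by linarith) (integrableOn_Ioi_div_pow
    (by fun_prop) (C := 1) (fun u => by
      rw [abs_of_nonneg (sq_nonneg _)]; exact Real.cos_sq_le_one u) (by positivity))]
  have h1 := intervalIntegral_cos_sq_le
  have h2 := setIntegral_cos_sq_tail
  have h3 : 1 / (9 * π ^ 2) = 1 / 9 * (1 / π ^ 2) := by field_simp
  have h4 := inv_pi_sq_bounds.2.1
  rw [h3] at h2
  linarith

theorem integrableOn_Ioi_abs_cos {c : ℝ} (hc : 0 < c) :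
    IntegrableOn (fun u => |cos u| / u ^ 3) (Ioi c) :=
  integrableOn_Ioi_div_pow (by fun_prop) (C := 1) (fun u => by simpa using Real.abs_cos_le_one u) hc

theorem integrableOn_Ioi_cos_sq {c : ℝ} (hc : 0 < c) :
    IntegrableOn (fun u => cos u ^ 2 / u ^ 3) (Ioi c) :=
  integrableOn_Ioi_div_pow (by fun_prop) (C := 1) (fun u => by
      rw [abs_of_nonneg (sq_nonneg _)]; exact Real.cos_sq_le_one u) hc

theorem integrableOn_Ioi_abs_cos_rpow {s c : ℝ} (hs : 0 ≤ s) (hc : 0 < c) :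
    IntegrableOn (fun u => |cos u| ^ s / u ^ 3) (Ioi c) :=
  integrableOn_Ioi_div_pow (by fun_prop) (C := 1) (fun u => by
      rw [abs_of_nonneg (by positivity)]
      exact Real.rpow_le_one (abs_nonneg _) (Real.abs_cos_le_one u) hs) hc

theorem abs_cos_rpow_le_of_two_le {s : ℝ} (hs : 2 ≤ s) (u : ℝ) : |cos u| ^ s ≤ cos u ^ 2 := by
  rcases (abs_nonneg (cos u)).eq_or_lt with h | h
  · rw [← h, Real.zero_rpow (by linarith)]; positivity
  · calc |cos u| ^ s ≤ |cos u| ^ (2 : ℝ) :=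
        Real.rpow_le_rpow_of_exponent_ge h (Real.abs_cos_le_one u) hs
      _ = cos u ^ 2 := by norm_cast; exact sq_abs _

theorem abs_cos_rpow_one_add_le {r : ℝ} (hr0 : 0 ≤ r) (hr1 : r ≤ 1) (u : ℝ) :
    |cos u| ^ (1 + r) ≤ (1 - r) * |cos u| + r * cos u ^ 2 := by
  have h := Real.geom_mean_le_arith_mean2_weighted hr0 (sub_nonneg.2 hr1) (abs_nonneg (cos u))
    zero_le_one (by ring)
  rw [Real.one_rpow, mul_one, mul_one] at h
  rw [Real.rpow_add_of_nonneg (abs_nonneg _) zero_le_one hr0, Real.rpow_one, ← sq_abs (cos u)]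
  nlinarith [mul_le_mul_of_nonneg_left h (abs_nonneg (cos u))]

theorem le_intervalIntegral_div_cube {f g : ℝ → ℝ} (hf : Continuous f) (hg : Continuous g)
    {x D : ℝ} (hx : 0 ≤ x) (hD : (π / 2 + x) ^ 3 ≤ D) (hg0 : ∀ t ∈ Icc 0 x, 0 ≤ g t)
    (hfg : ∀ t ∈ Icc 0 x, g t ≤ f (π / 2 + t)) :
    (∫ t in (0 : ℝ)..x, g t) / D ≤ ∫ u in (π / 2)..(π / 2 + x), f u / u ^ 3 := by
  have hpi := Real.pi_pos
  have := intervalIntegral.integral_comp_add_left (a := 0) (b := x) (fun u => f u / u ^ 3) (π / 2)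
  rw [add_zero] at this
  rw [← this, ← intervalIntegral.integral_div]
  have h1 : ContinuousOn (fun x => f (π / 2 + x) / (π / 2 + x) ^ 3) (uIcc 0 x) := by
    refine ContinuousOn.div (by fun_prop) (by fun_prop) fun y hy => ?_
    rw [uIcc_of_le hx] at hy
    have : 0 < π / 2 + y := by linarith [hy.1]
    positivity
  refine intervalIntegral.integral_mono_on hx (by apply Continuous.intervalIntegrable; fun_prop)
    h1.intervalIntegrable fun t ht => ?_
  have h0 := ht.1
  have h2 : (π / 2 + t) ^ 3 ≤ D := le_trans (by gcongr; exact ht.2) hD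
  exact div_le_div₀ ((hg0 t ht).trans (hfg t ht)) (hfg t ht) (by positivity) h2

/-- The exponent 1 + r is interpolated between 1 and 2. From both integrals over (π/2, ∞) the mass
on (π/2, π/2 + x) is removed, bounded below by sin t ≥ t − t³/6 and u³ ≤ D. The interpolated bound
decreases in r, since the cos² integral is the smaller one, so r may be replaced by r₁. -/
theorem setIntegral_abs_cos_rpow_lt {r r₁ x D : ℝ} (hr1 : 0 ≤ r₁) (hr : r₁ ≤ r) (hr' : r ≤ 1)
    (hx0 : 0 ≤ x) (hx1 : x ≤ 1) (hD : (1.5708 + x) ^ 3 ≤ D)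
    (h : (1 - r₁) * (10432 / 100000 - (x ^ 2 / 2 - x ^ 4 / 24) / D)
      + r₁ * (7436 / 100000 - (x ^ 3 / 3 - x ^ 5 / 15) / D) < 1 / 12) :
    ∫ u in Ioi (π / 2 + x), |cos u| ^ (1 + r) / u ^ 3 < 1 / 12 := by
  have hpi := Real.pi_pos
  have hD' : (π / 2 + x) ^ 3 ≤ D := by
    refine le_trans ?_ hD
    gcongr
    linarith [Real.pi_lt_d4]
  have hT : 0 < π / 2 + x := by positivity
  have i1 := setIntegral_Ioi_add (b := π / 2 + x) (by linarith)
    (integrableOn_Ioi_abs_cos (c := π / 2) (by positivity))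
  have i2 := setIntegral_Ioi_add (b := π / 2 + x) (by linarith)
    (integrableOn_Ioi_cos_sq (c := π / 2) (by positivity))
  have a1 := setIntegral_abs_cos_le
  have a2 := setIntegral_cos_sq_le
  have hcos (t : ℝ) : cos (π / 2 + t) = - sin t := by
    rw [add_comm, Real.cos_add_pi_div_two]
  have hg0 (t : ℝ) (ht : t ∈ Icc 0 x) : 0 ≤ t - t ^ 3 / 6 := by
    have h1 : t ^ 2 ≤ 1 := by nlinarith [ht.1, ht.2]
    nlinarith [ht.1]
  have b1 := le_intervalIntegral_div_cube (f := fun u => |cos u|) (g := fun t => t - t ^ 3 / 6)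
    (by fun_prop) (by fun_prop) hx0 hD' hg0 (fun t ht => by
      rw [hcos, abs_neg]
      exact (Real.sin_ge_sub_cube ht.1).trans (le_abs_self _))
  have b2 := le_intervalIntegral_div_cube (f := fun u => cos u ^ 2) (g := fun t => t ^ 2 - t ^ 4 / 3)
    (by fun_prop) (by fun_prop) hx0 hD' (fun t ht => by
      have h1 : t ^ 2 ≤ 1 := by nlinarith [ht.1, ht.2]
      nlinarith [sq_nonneg t]) (fun t ht => by
      rw [hcos, neg_sq]
      have := pow_le_pow_left₀ (hg0 t ht) (Real.sin_ge_sub_cube ht.1) 2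
      nlinarith [sq_nonneg (t ^ 3)])
  have c1 : ∫ t in (0 : ℝ)..x, (t - t ^ 3 / 6) = x ^ 2 / 2 - x ^ 4 / 24 := by
    rw [intervalIntegral.integral_sub (by apply Continuous.intervalIntegrable; fun_prop)
      (by apply Continuous.intervalIntegrable; fun_prop), intervalIntegral.integral_div]
    simp only [integral_pow, integral_id]
    norm_num
    ring
  have c2 : ∫ t in (0 : ℝ)..x, (t ^ 2 - t ^ 4 / 3) = x ^ 3 / 3 - x ^ 5 / 15 := by
    rw [intervalIntegral.integral_sub (by apply Continuous.intervalIntegrable; fun_prop)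
      (by apply Continuous.intervalIntegrable; fun_prop), intervalIntegral.integral_div]
    simp only [integral_pow]
    norm_num
    ring
  rw [c1] at b1
  rw [c2] at b2
  have j1 := integrableOn_Ioi_abs_cos hT
  have j2 := integrableOn_Ioi_cos_sq hT
  have hle : ∀ u ∈ Ioi (π / 2 + x), |cos u| ^ (1 + r) / u ^ 3 ≤
      (1 - r) * (|cos u| / u ^ 3) + r * (cos u ^ 2 / u ^ 3) := fun u hu => by
    have hu0 : 0 < u := hT.trans hu
    calc _ ≤ ((1 - r) * |cos u| + r * cos u ^ 2) / u ^ 3 := by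
          gcongr; exact abs_cos_rpow_one_add_le (hr1.trans hr) hr' u
      _ = _ := by ring
  have k1 := setIntegral_mono_on (integrableOn_Ioi_abs_cos_rpow (s := 1 + r) (by linarith) hT)
    ((j1.const_mul (1 - r)).add (j2.const_mul r)) measurableSet_Ioi hle
  simp only [Pi.add_apply] at k1
  rw [integral_add (j1.const_mul (1 - r)) (j2.const_mul r), integral_const_mul,
    integral_const_mul] at k1
  have k2 : ∫ u in Ioi (π / 2 + x), cos u ^ 2 / u ^ 3 ≤ ∫ u in Ioi (π / 2 + x), |cos u| / u ^ 3 := by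
    refine setIntegral_mono_on j2 j1 measurableSet_Ioi fun u hu => ?_
    have hu0 : 0 < u := hT.trans hu
    gcongr
    rw [← sq_abs]
    nlinarith [abs_nonneg (cos u), Real.abs_cos_le_one u]
  generalize (∫ u in Ioi (π / 2 + x), cos u ^ 2 / u ^ 3) = I2 at *
  generalize (∫ u in Ioi (π / 2 + x), |cos u| / u ^ 3) = I1 at *
  have l1 : I1 ≤ 10432 / 100000 - (x ^ 2 / 2 - x ^ 4 / 24) / D := by linarith
  have l2 : I2 ≤ 7436 / 100000 - (x ^ 3 / 3 - x ^ 5 / 15) / D := by linarith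
  have m1 := mul_le_mul_of_nonneg_left l1 (show 0 ≤ 1 - r₁ by linarith)
  have m2 := mul_le_mul_of_nonneg_left l2 hr1
  nlinarith [mul_nonneg (sub_nonneg.2 hr) (sub_nonneg.2 k2)]

/-- The oscillating tail of `|cos u| ^ s / u ^ 3` past a suitable point `T` has mass less than
`1 / 12`. -/
theorem exists_setIntegral_abs_cos_rpow_lt {s : ℝ} (hs : 1 ≤ s) :
    ∃ T, π / 2 ≤ T ∧ T < π ∧ (T = π / 2 ∨ (s - 1) * T ^ 2 ≤ (π / 2) ^ 2) ∧
      ∫ u in Ioi T, |cos u| ^ s / u ^ 3 < 1 / 12 := by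
  have hpi := Real.pi_pos
  have hl := Real.pi_gt_d4
  have hu := Real.pi_lt_d4
  rcases le_total 2 s with h2 | h2
  · refine ⟨π / 2, le_rfl, by linarith, Or.inl rfl, lt_of_le_of_lt ?_
      (show (7436 / 100000 : ℝ) < 1 / 12 by norm_num)⟩
    refine le_trans (setIntegral_mono_on (integrableOn_Ioi_abs_cos_rpow (by linarith)
      (by positivity)) (integrableOn_Ioi_cos_sq (by positivity)) measurableSet_Ioi
      fun u hu => ?_) setIntegral_cos_sq_le
    have hu0 : 0 < u := lt_trans (by positivity) hu
    gcongr
    exact abs_cos_rpow_le_of_two_le h2 u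
  obtain ⟨r, rfl⟩ : ∃ r, s = 1 + r := ⟨s - 1, by ring⟩
  have hr0 : 0 ≤ r := by linarith
  have hr1 : r ≤ 1 := by linarith
  have hT {x R : ℝ} (hx : 0 ≤ x) (hrR : r ≤ R) (h : R * (1 + x / 1.57) ^ 2 ≤ 1) :
      (1 + r - 1) * (π / 2 + x) ^ 2 ≤ (π / 2) ^ 2 := by
    have h1 : (π / 2 + x) ≤ π / 2 * (1 + x / 1.57) := by
      have : x ≤ π / 2 * (x / 1.57) := by rw [mul_div_assoc', le_div_iff₀ (by norm_num)]; nlinarith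
      linarith
    calc (1 + r - 1) * (π / 2 + x) ^ 2 = r * (π / 2 + x) ^ 2 := by ring
      _ ≤ R * (π / 2 * (1 + x / 1.57)) ^ 2 := by gcongr; linarith
      _ = (π / 2) ^ 2 * (R * (1 + x / 1.57) ^ 2) := by ring
      _ ≤ (π / 2) ^ 2 * 1 := by gcongr
      _ = _ := by ring
  -- On each range of r the shift x is large enough for the tail bound at the lower end and small
  -- enough for (s − 1) T² ≤ (π/2)² at the upper end. For r ≥ 3/4 no shift is needed.
  rcases le_total (3 / 4) r with h | h
  · refine ⟨π / 2 + 0, by linarith, by linarith, Or.inl (by ring),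
      setIntegral_abs_cos_rpow_lt (by norm_num) h hr1 le_rfl (by norm_num) le_rfl (by norm_num)⟩
  rcases le_total (13 / 20) r with h' | h'
  · exact ⟨π / 2 + 0.24, by linarith, by linarith, Or.inr (hT (by norm_num) h (by norm_num)),
      setIntegral_abs_cos_rpow_lt (by norm_num) h' hr1 (by norm_num) (by norm_num) le_rfl
        (by norm_num)⟩
  rcases le_total (11 / 20) r with h | h
  · exact ⟨π / 2 + 0.375, by linarith, by linarith, Or.inr (hT (by norm_num) h' (by norm_num)),
      setIntegral_abs_cos_rpow_lt (by norm_num) h hr1 (by norm_num) (by norm_num) le_rfl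
        (by norm_num)⟩
  rcases le_total (2 / 5) r with h' | h'
  · exact ⟨π / 2 + 0.54, by linarith, by linarith, Or.inr (hT (by norm_num) h (by norm_num)),
      setIntegral_abs_cos_rpow_lt (by norm_num) h' hr1 (by norm_num) (by norm_num) le_rfl
        (by norm_num)⟩
  · exact ⟨π / 2 + 0.91, by linarith, by linarith, Or.inr (hT (by norm_num) h' (by norm_num)),
      setIntegral_abs_cos_rpow_lt (by norm_num) hr0 hr1 (by norm_num) (by norm_num) le_rfl
        (by norm_num)⟩

/-! ### Comparison of a power of the cosine with a Gaussian. -/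

theorem cos_le_one_sub_add {u : ℝ} (hu : 0 ≤ u) : cos u ≤ 1 - u ^ 2 / 2 + u ^ 4 / 24 := by
  have hd (t : ℝ) : HasDerivAt (fun t : ℝ => 1 - t ^ 2 / 2 + t ^ 4 / 24 - cos t)
      (-(t - t ^ 3 / 6) + sin t) t := by
    have := ((((hasDerivAt_pow 2 t).div_const 2).const_sub 1).add
      ((hasDerivAt_pow 4 t).div_const 24)).sub (Real.hasDerivAt_cos t)
    refine this.congr_deriv ?_
    push_cast
    ring
  have hm : MonotoneOn (fun t : ℝ => 1 - t ^ 2 / 2 + t ^ 4 / 24 - cos t) (Ici 0) := by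
    refine monotoneOn_of_deriv_nonneg (convex_Ici 0)
      (fun t _ => (hd t).continuousAt.continuousWithinAt)
      (fun t _ => (hd t).differentiableAt.differentiableWithinAt) fun t ht => ?_
    rw [interior_Ici] at ht
    rw [(hd t).deriv]
    linarith [Real.sin_ge_sub_cube (le_of_lt ht)]
  have := hm self_mem_Ici hu hu
  simp at this
  linarith

/-- The exponent agrees with log cos u = −u²/2 − u⁴/12 − … through order 4, and the quartic term is
the source of the gain 1/12. The ratio of the two sides is decreasing: with Taylor bounds for sin
and cos, the sign of its derivative comes down to t⁵ (9 − t²) ≥ 0. -/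
theorem cos_le_exp_neg {u : ℝ} (h0 : 0 ≤ u) (hu : u ≤ π / 2) :
    cos u ≤ exp (-(3 * u ^ 2 / (6 - u ^ 2))) := by
  have hsq {t : ℝ} (ht0 : 0 ≤ t) (ht : t ≤ π / 2) : 0 < 6 - t ^ 2 := by
    have : t ≤ 2 := by linarith [Real.pi_lt_four]
    nlinarith
  have hd {t : ℝ} (ht0 : 0 ≤ t) (ht : t ≤ π / 2) :
      HasDerivAt (fun t : ℝ => cos t * exp (3 * t ^ 2 / (6 - t ^ 2)))
      (exp (3 * t ^ 2 / (6 - t ^ 2)) * (36 * t * cos t / (6 - t ^ 2) ^ 2 - sin t)) t := by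
    have h := hsq ht0 ht
    have := (Real.hasDerivAt_cos t).mul
      ((((hasDerivAt_pow 2 t).const_mul 3).div ((hasDerivAt_pow 2 t).const_sub 6) h.ne').exp)
    refine this.congr_deriv ?_
    simp only [Pi.div_apply]
    field_simp
    push_cast
    ring
  have hm : AntitoneOn (fun t : ℝ => cos t * exp (3 * t ^ 2 / (6 - t ^ 2))) (Icc 0 (π / 2)) := by
    refine antitoneOn_of_deriv_nonpos (convex_Icc _ _)
      (fun t ht => (hd ht.1 ht.2).continuousAt.continuousWithinAt) (fun t ht => ?_) fun t ht => ?_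
    · rw [interior_Icc] at ht
      exact (hd ht.1.le ht.2.le).differentiableAt.differentiableWithinAt
    rw [interior_Icc] at ht
    have h := hsq ht.1.le ht.2.le
    rw [(hd ht.1.le ht.2.le).deriv]
    refine mul_nonpos_of_nonneg_of_nonpos (Real.exp_pos _).le ?_
    rw [sub_nonpos, div_le_iff₀ (by positivity)]
    have h1 := cos_le_one_sub_add ht.1.le
    have h2 := Real.sin_ge_sub_cube ht.1.le
    have ht0 := ht.1
    calc 36 * t * cos t ≤ 36 * t * (1 - t ^ 2 / 2 + t ^ 4 / 24) := by gcongr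
      _ ≤ (t - t ^ 3 / 6) * (6 - t ^ 2) ^ 2 := by
        have : 0 ≤ t ^ 5 * (9 - t ^ 2) := by
          apply mul_nonneg (by positivity); linarith
        nlinarith
      _ ≤ sin t * (6 - t ^ 2) ^ 2 := by gcongr
  have := hm ⟨le_rfl, by positivity⟩ ⟨h0, hu⟩ h0
  simp at this
  rw [Real.exp_neg, ← one_div, le_div_iff₀ (Real.exp_pos _)]
  exact this

/-- The gain near the origin when `cos u ^ s` is compared with a Gaussian. -/
theorem exp_div_le_intervalIntegral_sub {s η : ℝ} (hs : 0 < s) (hη : 0 < η) (hη' : η < π / 2) :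
    exp (-s * (6 * η ^ 2 / (6 - η ^ 2)) / 2) / 12 ≤
      (∫ u in η..π, exp (-s * u ^ 2 / 2) / u ^ 3) - ∫ u in η..(π / 2), |cos u| ^ s / u ^ 3 := by
  have hpi := Real.pi_pos
  have hpi4 := Real.pi_lt_four
  have hsq {t : ℝ} (ht0 : 0 ≤ t) (ht : t ≤ π / 2) : 0 < 6 - t ^ 2 := by
    have : t ≤ 2 := by linarith
    nlinarith
  -- Since 1/w² = 1/u² − 1/6, the substitution v = w u satisfies dv/v³ = du/u³, while cos u ≤ exp
  -- (−w²/2). The cosine integral is thus at most the Gaussian one started at w η, and [η, w η] has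
  -- mass exactly 1/12 for dv/v³.
  set w : ℝ → ℝ := fun u => u / √(1 - u ^ 2 / 6) with hw
  have hroot {t : ℝ} (ht0 : 0 ≤ t) (ht : t ≤ π / 2) : 0 < √(1 - t ^ 2 / 6) :=
    Real.sqrt_pos.2 (by linarith [hsq ht0 ht])
  have hwpos {t : ℝ} (ht0 : 0 < t) (ht : t ≤ π / 2) : 0 < w t := div_pos ht0 (hroot ht0.le ht)
  have hwsq {t : ℝ} (ht0 : 0 ≤ t) (ht : t ≤ π / 2) : w t ^ 2 = 6 * t ^ 2 / (6 - t ^ 2) := by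
    have := hsq ht0 ht
    rw [hw, div_pow, Real.sq_sqrt (by linarith)]
    field_simp
  have hexp {a b : ℝ} (ha : 0 < a) (hb : 0 < b) :
      IntervalIntegrable (fun u => exp (-s * u ^ 2 / 2) / u ^ 3) volume a b := by
    apply ContinuousOn.intervalIntegrable
    refine ContinuousOn.div (by fun_prop) (by fun_prop) fun u hu => pow_ne_zero 3 ?_
    exact (lt_of_lt_of_le (lt_min ha hb) hu.1).ne'
  have hηw := hwpos hη hη'.le
  have hpw := hwpos (t := π / 2) (by positivity) le_rfl
  have hIcc : uIcc η (π / 2) = Icc η (π / 2) := uIcc_of_le hη'.le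
  have hcosint : IntervalIntegrable (fun u => |cos u| ^ s / u ^ 3) volume η (π / 2) := by
    apply ContinuousOn.intervalIntegrable
    refine ContinuousOn.div (Continuous.continuousOn ?_) (by fun_prop) fun u hu => pow_ne_zero 3 ?_
    · exact (by fun_prop : Continuous fun u => |cos u|).rpow_const fun _ => Or.inr hs.le
    · rw [hIcc] at hu
      exact (hη.trans_le hu.1).ne'
  have hd : ∀ t ∈ Icc η (π / 2), HasDerivAt w (w t ^ 3 / t ^ 3) t := by
    intro t ht
    have ht0 : 0 < t := hη.trans_le ht.1
    have h1 := hroot ht0.le ht.2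
    have h2 : 0 < 1 - t ^ 2 / 6 := by linarith [hsq ht0.le ht.2]
    have := (hasDerivAt_id t).div ((((hasDerivAt_pow 2 t).div_const 6).const_sub 1).sqrt h2.ne')
      h1.ne'
    refine this.congr_deriv ?_
    have h3 := Real.sq_sqrt h2.le
    simp only [hw, id]
    set r := √(1 - t ^ 2 / 6)
    push_cast
    field_simp
    nlinarith
  have hcov : ∫ u in η..(π / 2), exp (-s * (w u) ^ 2 / 2) / u ^ 3
      = ∫ v in (w η)..(w (π / 2)), exp (-s * v ^ 2 / 2) / v ^ 3 := by
    have hwc : ContinuousOn w (uIcc η (π / 2)) := by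
      rw [hIcc]; exact fun t ht => (hd t ht).continuousAt.continuousWithinAt
    rw [← intervalIntegral.integral_comp_mul_deriv'' (f := w)
      (f' := fun t => w t ^ 3 / t ^ 3) hwc]
    · refine intervalIntegral.integral_congr fun t ht => ?_
      rw [hIcc] at ht
      have h1 := hwpos (hη.trans_le ht.1) ht.2
      have h2 := hη.trans_le ht.1
      simp only [Function.comp]
      field_simp
    · intro t ht
      rw [min_eq_left hη'.le, max_eq_right hη'.le] at ht
      exact (hd t ⟨ht.1.le, ht.2.le⟩).hasDerivWithinAt
    · refine (hwc.pow 3).div (by fun_prop) fun u hu => pow_ne_zero 3 ?_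
      rw [hIcc] at hu
      exact (hη.trans_le hu.1).ne'
    · refine ContinuousOn.div (by fun_prop) (by fun_prop) ?_
      rintro _ ⟨u, hu, rfl⟩
      rw [hIcc] at hu
      exact pow_ne_zero 3 (hwpos (hη.trans_le hu.1) hu.2).ne'
  have hle : ∫ u in η..(π / 2), |cos u| ^ s / u ^ 3 ≤
      ∫ u in η..(π / 2), exp (-s * (w u) ^ 2 / 2) / u ^ 3 := by
    refine intervalIntegral.integral_mono_on hη'.le hcosint ?_ fun u hu => ?_
    · apply ContinuousOn.intervalIntegrable
      rw [hIcc]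
      refine ContinuousOn.div ?_ (by fun_prop) fun u hu => pow_ne_zero 3 (hη.trans_le hu.1).ne'
      have hwc : ContinuousOn w (Icc η (π / 2)) :=
        fun t ht => (hd t ht).continuousAt.continuousWithinAt
      fun_prop
    · have hu0 : 0 < u := hη.trans_le hu.1
      have h1 := cos_le_exp_neg hu0.le hu.2
      have h2 : 0 ≤ cos u := Real.cos_nonneg_of_mem_Icc ⟨by linarith, hu.2⟩
      gcongr
      rw [abs_of_nonneg h2, hwsq hu0.le hu.2]
      calc cos u ^ s ≤ exp (-(3 * u ^ 2 / (6 - u ^ 2))) ^ s := by gcongr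
        _ = _ := by
          rw [← Real.exp_mul]
          congr 1
          ring
  have hlow : exp (-s * (6 * η ^ 2 / (6 - η ^ 2)) / 2) / 12 ≤
      ∫ v in η..(w η), exp (-s * v ^ 2 / 2) / v ^ 3 := by
    have hη6 := hsq hη.le hη'.le
    have hηle : η ≤ w η := by
      rw [hw, le_div_iff₀ (hroot hη.le hη'.le)]
      have : √(1 - η ^ 2 / 6) ≤ 1 := Real.sqrt_le_one.2 (by nlinarith)
      nlinarith
    have hd' : ∀ v ∈ uIcc η (w η), HasDerivAt (fun v : ℝ =>
        exp (-s * (w η) ^ 2 / 2) * ((-1 / 2) / v ^ 2)) (exp (-s * (w η) ^ 2 / 2) / v ^ 3) v := by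
      intro v hv
      rw [uIcc_of_le hηle] at hv
      have hv0 : 0 < v := hη.trans_le hv.1
      have := ((hasDerivAt_const v (-1 / 2 : ℝ)).div (hasDerivAt_pow 2 v)
        (pow_ne_zero 2 hv0.ne')).const_mul (exp (-s * (w η) ^ 2 / 2))
      refine this.congr_deriv ?_
      push_cast
      field_simp
      ring
    have hint : IntervalIntegrable (fun v => exp (-s * (w η) ^ 2 / 2) / v ^ 3) volume η (w η) := by
      apply ContinuousOn.intervalIntegrable
      rw [uIcc_of_le hηle]
      exact ContinuousOn.div (by fun_prop) (by fun_prop)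
        fun u hu => pow_ne_zero 3 (hη.trans_le hu.1).ne'
    have h1 := intervalIntegral.integral_mono_on hηle hint (hexp hη hηw) fun v hv => by
      have hv0 : 0 < v := hη.trans_le hv.1
      have : v ^ 2 ≤ w η ^ 2 := by gcongr; exact hv.2
      show exp (-s * (w η) ^ 2 / 2) / v ^ 3 ≤ exp (-s * v ^ 2 / 2) / v ^ 3
      gcongr ?_ / _
      apply Real.exp_le_exp.2
      nlinarith
    rw [intervalIntegral.integral_eq_sub_of_hasDerivAt hd' hint] at h1
    refine le_trans (le_of_eq ?_) h1
    rw [hwsq hη.le hη'.le]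
    field_simp
    ring
  -- The Gaussian may be truncated at π because w (π/2) ≤ π, that is, π² ≤ 18.
  have hupp : 0 ≤ ∫ v in (w (π / 2))..π, exp (-s * v ^ 2 / 2) / v ^ 3 := by
    refine intervalIntegral.integral_nonneg ?_ fun u hu => ?_
    · refine abs_le_of_sq_le_sq' ?_ hpi.le |>.2
      rw [hwsq (by positivity) le_rfl, div_le_iff₀ (hsq (by positivity) le_rfl)]
      have : π ≤ 3.2 := by linarith [Real.pi_lt_d2]
      have h2 : π ^ 2 ≤ 18 := by nlinarith
      nlinarith [sq_nonneg π]
    · have : 0 < u := hpw.trans_le hu.1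
      positivity
  rw [hcov] at hle
  have e1 := intervalIntegral.integral_add_adjacent_intervals (hexp hη hηw) (hexp hηw hpi)
  have e2 := intervalIntegral.integral_add_adjacent_intervals (hexp hηw hpw) (hexp hpw hpi)
  linarith

/-- `|cos| ^ s`, cut off on `(π / 2, T)`, minus a Gaussian truncated at `π`. -/
noncomputable def cosSubGauss (s T u : ℝ) : ℝ :=
  (Ioo (π / 2) T)ᶜ.indicator (fun u => |cos u| ^ s) u
    - (Iic π).indicator (fun u => exp (-s * u ^ 2 / 2)) u

theorem measurable_cosSubGauss (s T : ℝ) : Measurable (cosSubGauss s T) :=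
  (Measurable.indicator (by fun_prop) measurableSet_Ioo.compl).sub
    (Measurable.indicator (by fun_prop) measurableSet_Iic)

theorem abs_cosSubGauss_le {s : ℝ} (hs : 0 ≤ s) (T u : ℝ) : |cosSubGauss s T u| ≤ 2 := by
  have h1 : 0 ≤ |cos u| ^ s := by positivity
  have h2 : |cos u| ^ s ≤ 1 := Real.rpow_le_one (abs_nonneg _) (Real.abs_cos_le_one u) hs
  have h3 := Real.exp_pos (-s * u ^ 2 / 2)
  have h4 : exp (-s * u ^ 2 / 2) ≤ 1 := Real.exp_le_one_iff.2 (by nlinarith [sq_nonneg u])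
  unfold cosSubGauss
  simp only [indicator_apply]
  rw [abs_le]
  split_ifs <;> constructor <;> linarith

theorem integrableOn_Ioi_mul_rpow {f : ℝ → ℝ} (hf : Measurable f) {C : ℝ} (hC : ∀ u, |f u| ≤ C)
    {c q : ℝ} (hc : 0 < c) (hq : q < -1) : IntegrableOn (fun u => f u * u ^ q) (Ioi c) :=
  (integrableOn_Ioi_rpow_of_lt hq hc).bdd_mul hf.aestronglyMeasurable
    (Eventually.of_forall fun u => by simpa using hC u)

theorem setIntegral_cosSubGauss_div_cube {s T η : ℝ} (hs : 0 < s) (hT : π / 2 ≤ T)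
    (hη : 0 < η) (hη' : η < π / 2) :
    ∫ u in Ioi η, cosSubGauss s T u / u ^ 3 ≤ (∫ u in Ioi T, |cos u| ^ s / u ^ 3)
      - exp (-s * (6 * η ^ 2 / (6 - η ^ 2)) / 2) / 12 := by
  have hpi := Real.pi_pos
  have hT0 : 0 < T := lt_of_lt_of_le (by positivity) hT
  have h1 (u : ℝ) : 0 ≤ |cos u| ^ s := by positivity
  have h2 (u : ℝ) : |cos u| ^ s ≤ 1 :=
    Real.rpow_le_one (abs_nonneg _) (Real.abs_cos_le_one u) hs.le
  have h3 (u : ℝ) := Real.exp_pos (-s * u ^ 2 / 2)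
  have h4 (u : ℝ) : exp (-s * u ^ 2 / 2) ≤ 1 := Real.exp_le_one_iff.2 (by nlinarith [sq_nonneg u])
  have i1 {c : ℝ} (hc : 0 < c) : IntegrableOn (fun u =>
      (Ioo (π / 2) T)ᶜ.indicator (fun u => |cos u| ^ s) u / u ^ 3) (Ioi c) :=
    integrableOn_Ioi_div_pow (Measurable.indicator (by fun_prop) measurableSet_Ioo.compl) (C := 1)
      (fun u => by
        simp only [indicator_apply]
        split_ifs
        · rw [abs_of_nonneg (h1 u)]; exact h2 u
        · simp) hc
  have i2 {c : ℝ} (hc : 0 < c) : IntegrableOn (fun u =>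
      (Iic π).indicator (fun u => exp (-s * u ^ 2 / 2)) u / u ^ 3) (Ioi c) :=
    integrableOn_Ioi_div_pow (Measurable.indicator (by fun_prop) measurableSet_Iic) (C := 1)
      (fun u => by
        simp only [indicator_apply]
        split_ifs
        · rw [abs_of_nonneg (h3 u).le]; exact h4 u
        · simp) hc
  have e : ∫ u in Ioi η, cosSubGauss s T u / u ^ 3 =
      (∫ u in Ioi η, (Ioo (π / 2) T)ᶜ.indicator (fun u => |cos u| ^ s) u / u ^ 3)
      - ∫ u in Ioi η, (Iic π).indicator (fun u => exp (-s * u ^ 2 / 2)) u / u ^ 3 := by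
    rw [← integral_sub (i1 hη) (i2 hη)]
    simp only [cosSubGauss, sub_div]
  have e1 : ∫ u in Ioi η, (Ioo (π / 2) T)ᶜ.indicator (fun u => |cos u| ^ s) u / u ^ 3
      = (∫ u in η..(π / 2), |cos u| ^ s / u ^ 3) + ∫ u in Ioi T, |cos u| ^ s / u ^ 3 := by
    rw [setIntegral_Ioi_add hη'.le (i1 hη), setIntegral_Ioi_add hT (i1 (by positivity))]
    have a1 : ∫ u in (π / 2)..T, (Ioo (π / 2) T)ᶜ.indicator (fun u => |cos u| ^ s) u / u ^ 3 = 0 := by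
      rw [intervalIntegral.integral_of_le hT, ← integral_Ioc_eq_integral_Ioo.symm]
      refine setIntegral_eq_zero_of_forall_eq_zero fun u hu => ?_
      simp [hu.1, hu.2]
    rw [a1, zero_add]
    congr 1
    · refine intervalIntegral.integral_congr fun u hu => ?_
      rw [uIcc_of_le hη'.le] at hu
      simp [not_lt.2 hu.2]
    · refine setIntegral_congr_fun measurableSet_Ioi fun u hu => ?_
      simp [not_lt.2 (le_of_lt (mem_Ioi.1 hu))]
  have e2 : ∫ u in Ioi η, (Iic π).indicator (fun u => exp (-s * u ^ 2 / 2)) u / u ^ 3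
      = ∫ u in η..π, exp (-s * u ^ 2 / 2) / u ^ 3 := by
    rw [setIntegral_Ioi_add (by linarith : η ≤ π) (i2 hη)]
    have a1 : ∫ u in Ioi π, (Iic π).indicator (fun u => exp (-s * u ^ 2 / 2)) u / u ^ 3 = 0 := by
      refine setIntegral_eq_zero_of_forall_eq_zero fun u hu => ?_
      simp [not_le.2 (mem_Ioi.1 hu)]
    rw [a1, add_zero]
    refine intervalIntegral.integral_congr fun u hu => ?_
    rw [uIcc_of_le (by linarith)] at hu
    simp [hu.2]
  rw [e, e1, e2]
  linarith [exp_div_le_intervalIntegral_sub hs hη hη']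

theorem cos_le_exp_neg_sq {u : ℝ} (h0 : 0 ≤ u) (hu : u ≤ π / 2) : cos u ≤ exp (-u ^ 2 / 2) := by
  refine (cos_le_exp_neg h0 hu).trans (Real.exp_le_exp.2 ?_)
  have h2 : u ≤ 2 := by linarith [Real.pi_lt_four]
  have : 0 < 6 - u ^ 2 := by nlinarith
  rw [neg_div, neg_le_neg_iff, div_le_div_iff₀ (by norm_num) this]
  nlinarith [mul_nonneg (sq_nonneg u) (sq_nonneg u)]

theorem exp_neg_sq_rpow (s u : ℝ) : exp (-u ^ 2 / 2) ^ s = exp (-s * u ^ 2 / 2) := by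
  rw [← Real.exp_mul]; congr 1; ring

/-- `cosSubGauss s T` changes sign exactly once on the positive half line. -/
theorem exists_cosSubGauss_sign {s T : ℝ} (hs : 0 < s) (hT : π / 2 ≤ T) (hT' : T < π) :
    ∃ c, 0 < c ∧ (∀ u, 0 < u → u < c → cosSubGauss s T u ≤ 0) ∧
      ∀ u, c < u → 0 ≤ cosSubGauss s T u := by
  have hpi := Real.pi_pos
  -- Up to π and outside the gap both terms are s-th powers, so their order is that of the bases,
  -- whatever s is. Past π/2 one base increases and the other decreases, which leaves a single
  -- crossing; in the gap and beyond π the sign is evident.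
  have hf : MonotoneOn (fun u => -cos u - exp (-u ^ 2 / 2)) (Icc (π / 2) π) := by
    intro u hu v hv huv
    have h1 : cos v ≤ cos u := Real.cos_le_cos_of_nonneg_of_le_pi (by linarith [hu.1]) hv.2 huv
    have h2 : exp (-v ^ 2 / 2) ≤ exp (-u ^ 2 / 2) := by
      apply Real.exp_le_exp.2
      have : u ^ 2 ≤ v ^ 2 := by
        have := hu.1
        gcongr
        linarith
      linarith
    show _ ≤ _
    simp only
    linarith
  have hpos {u : ℝ} (hu : π / 2 ≤ u) (hu' : u ≤ π) : |cos u| = -cos u :=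
    abs_of_nonpos (Real.cos_nonpos_of_pi_div_two_le_of_le hu (by linarith))
  obtain ⟨c, hcT, hcπ, hc1, hc2⟩ : ∃ c, T ≤ c ∧ c ≤ π ∧
      (∀ u, T ≤ u → u < c → -cos u - exp (-u ^ 2 / 2) ≤ 0) ∧ 0 ≤ -cos c - exp (-c ^ 2 / 2) := by
    rcases le_total 0 (-cos T - exp (-T ^ 2 / 2)) with h | h
    · exact ⟨T, le_rfl, hT'.le, fun u h1 h2 => absurd h2 (not_lt.2 h1), h⟩
    · have hπ : 0 ≤ -cos π - exp (-π ^ 2 / 2) := by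
        have : exp (-π ^ 2 / 2) ≤ 1 := Real.exp_le_one_iff.2 (by nlinarith)
        rw [Real.cos_pi]
        linarith
      obtain ⟨c, hc, hc0⟩ := intermediate_value_Icc hT'.le
        (f := fun u => -cos u - exp (-u ^ 2 / 2)) (by fun_prop) ⟨h, hπ⟩
      simp only at hc0
      refine ⟨c, hc.1, hc.2, fun u h1 h2 => ?_, hc0.ge⟩
      rw [← hc0]
      exact hf ⟨hT.trans h1, by linarith [hc.2]⟩ ⟨hT.trans hc.1, hc.2⟩ h2.le
  refine ⟨c, by linarith, fun u hu0 huc => ?_, fun u huc => ?_⟩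
  · have huπ : u ≤ π := by linarith
    have he := Real.exp_pos (-s * u ^ 2 / 2)
    simp only [cosSubGauss, indicator_apply, mem_Iic, huπ, if_true]
    split_ifs with h
    · rw [sub_nonpos, ← exp_neg_sq_rpow]
      refine Real.rpow_le_rpow (abs_nonneg _) ?_ hs.le
      rcases le_or_gt u (π / 2) with h' | h'
      · rw [abs_of_nonneg (Real.cos_nonneg_of_mem_Icc ⟨by linarith, h'⟩)]
        exact cos_le_exp_neg_sq hu0.le h'
      · have hTu : T ≤ u := by
          by_contra hh
          exact h ⟨h', not_le.1 hh⟩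
        rw [hpos h'.le huπ]
        linarith [hc1 u hTu huc]
    · linarith
  · have h : u ∈ (Ioo (π / 2) T)ᶜ := fun h => by linarith [h.2]
    simp only [cosSubGauss, indicator_apply, h, if_true, mem_Iic]
    split_ifs with huπ
    · rw [sub_nonneg, ← exp_neg_sq_rpow]
      refine Real.rpow_le_rpow (Real.exp_pos _).le ?_ hs.le
      rw [hpos (by linarith) huπ]
      have := hf ⟨hT.trans hcT, hcπ⟩ ⟨by linarith, huπ⟩ huc.le
      simp only at this
      linarith
    · rw [sub_zero]; positivity

/-- Since u^(2 − p) is nonincreasing, replacing it by its value at the sign change c can only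
increase the integral. This reduces all p ≥ 2 to the weight u⁻³, where the gain tends to 1/12 as η →
0 and so exceeds the tail. -/
theorem eventually_setIntegral_cosSubGauss_nonpos {s T p : ℝ} (hs : 0 < s) (hT : π / 2 ≤ T)
    (hT' : T < π) (hL : ∫ u in Ioi T, |cos u| ^ s / u ^ 3 < 1 / 12) (hp : 2 ≤ p) :
    ∀ᶠ η in 𝓝[>] (0 : ℝ), ∫ u in Ioi η, cosSubGauss s T u * u ^ (-p - 1) ≤ 0 := by
  have hpi := Real.pi_pos
  obtain ⟨c, hc, hneg, hpos⟩ := exists_cosSubGauss_sign hs hT hT'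
  have hlim : Tendsto (fun η : ℝ => exp (-s * (6 * η ^ 2 / (6 - η ^ 2)) / 2) / 12) (𝓝[>] 0)
      (𝓝 (1 / 12)) := by
    have : ContinuousAt (fun η : ℝ => exp (-s * (6 * η ^ 2 / (6 - η ^ 2)) / 2) / 12) 0 := by
      have : ContinuousAt (fun η : ℝ => 6 * η ^ 2 / (6 - η ^ 2)) 0 :=
        ContinuousAt.div (by fun_prop) (by fun_prop) (by norm_num)
      fun_prop
    have h := this.tendsto
    simp only [ne_eq, OfNat.ofNat_ne_zero, not_false_eq_true, zero_pow, mul_zero, zero_div,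
      Real.exp_zero] at h
    exact h.mono_left nhdsWithin_le_nhds
  filter_upwards [hlim.eventually_const_lt hL, self_mem_nhdsWithin,
    Ioo_mem_nhdsGT (show (0 : ℝ) < π / 2 by positivity)] with η h1 hη h2
  have hη : 0 < η := hη
  have h3 := setIntegral_cosSubGauss_div_cube hs hT hη h2.2
  have hm := measurable_cosSubGauss s T
  have hb := abs_cosSubGauss_le hs.le T
  calc ∫ u in Ioi η, cosSubGauss s T u * u ^ (-p - 1)
      ≤ ∫ u in Ioi η, c ^ (2 - p) * (cosSubGauss s T u / u ^ 3) := by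
        refine setIntegral_mono_on (integrableOn_Ioi_mul_rpow hm hb hη (by linarith))
          ((integrableOn_Ioi_div_pow hm hb hη).const_mul _) measurableSet_Ioi fun u hu => ?_
        have hu : 0 < u := hη.trans hu
        have e : u ^ (-p - 1) = u ^ (2 - p) / u ^ 3 := by
          rw [← Real.rpow_natCast u 3, ← Real.rpow_sub hu]
          congr 1
          push_cast
          ring
        rw [e, mul_div_assoc', mul_div_assoc', mul_comm (c ^ _)]
        gcongr ?_ / _
        rcases lt_trichotomy u c with h | h | h
        · exact mul_le_mul_of_nonpos_left
            (Real.rpow_le_rpow_of_nonpos hu h.le (by linarith)) (hneg u hu h)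
        · rw [h]
        · exact mul_le_mul_of_nonneg_left
            (Real.rpow_le_rpow_of_nonpos hc h.le (by linarith)) (hpos u h)
    _ = c ^ (2 - p) * ∫ u in Ioi η, cosSubGauss s T u / u ^ 3 := integral_const_mul _ _
    _ ≤ 0 := mul_nonpos_of_nonneg_of_nonpos (by positivity) (by linarith)

/-! ### Products of cosines against the Gaussian. -/

/-- Weighted AM-GM: a product of cosines minus a Gaussian is dominated by one-parameter terms. -/
theorem prod_cos_sub_exp_le {ι : Type*} {S : Finset ι} {a T : ι → ℝ} (ha : ∀ i ∈ S, 0 < a i)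
    (hsum : ∑ i ∈ S, a i ^ 2 = 1)
    (hT : ∀ i ∈ S, T i < π ∧ (T i = π / 2 ∨ (1 / a i ^ 2 - 1) * T i ^ 2 ≤ (π / 2) ^ 2))
    {t : ℝ} (ht : 0 < t) :
    ∏ i ∈ S, cos (a i * t) - exp (-t ^ 2 / 2) ≤
      ∑ i ∈ S, a i ^ 2 * cosSubGauss (1 / a i ^ 2) (T i) (a i * t) := by
  have hpi := Real.pi_pos
  have hg (i) (hi : i ∈ S) : (Iic π).indicator (fun u => exp (-(1 / a i ^ 2) * u ^ 2 / 2)) (a i * t)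
      ≤ exp (-t ^ 2 / 2) := by
    have h := ha i hi
    rw [indicator_apply]
    split_ifs
    · apply le_of_eq; congr 1; field_simp
    · positivity
  have hG : ∑ i ∈ S, a i ^ 2 *
      (Iic π).indicator (fun u => exp (-(1 / a i ^ 2) * u ^ 2 / 2)) (a i * t)
      ≤ exp (-t ^ 2 / 2) := by
    calc _ ≤ ∑ i ∈ S, a i ^ 2 * exp (-t ^ 2 / 2) :=
          Finset.sum_le_sum fun i hi => mul_le_mul_of_nonneg_left (hg i hi) (sq_nonneg _)
      _ = exp (-t ^ 2 / 2) := by rw [← Finset.sum_mul, hsum, one_mul]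
  simp only [cosSubGauss, mul_sub, Finset.sum_sub_distrib]
  refine sub_le_sub ?_ hG
  have hnn (i) (hi : i ∈ S) : 0 ≤ a i ^ 2 * (Ioo (π / 2) (T i))ᶜ.indicator
      (fun u => |cos u| ^ (1 / a i ^ 2)) (a i * t) := by
    apply mul_nonneg (sq_nonneg _)
    rw [indicator_apply]
    split_ifs <;> positivity
  -- If a_i t lies in its gap, then (a_j t)² ≤ (1 − a_i²) t² = (1/a_i² − 1) (a_i t)² ≤ (π/2)² for j
  -- ≠ i. One cosine is nonpositive and the others are nonnegative, so the product may be dropped.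
  -- Otherwise AM-GM applies to |cos (a_i t)|^(1/a_i²) with weights a_i².
  by_cases hex : ∃ i ∈ S, a i * t ∈ Ioo (π / 2) (T i)
  · obtain ⟨i, hi, hmem⟩ := hex
    refine le_trans ?_ (Finset.sum_nonneg hnn)
    classical
    rw [← Finset.mul_prod_erase S _ hi]
    have hai := ha i hi
    obtain ⟨hTπ, hTi⟩ := hT i hi
    refine mul_nonpos_of_nonpos_of_nonneg (Real.cos_nonpos_of_pi_div_two_le_of_le hmem.1.le
      (by linarith [hmem.2])) (Finset.prod_nonneg fun j hj => ?_)
    have hji := Finset.ne_of_mem_erase hj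
    have hjS := Finset.mem_of_mem_erase hj
    have haj := ha j hjS
    have hle : a j ^ 2 ≤ 1 - a i ^ 2 := by
      have : a i ^ 2 + a j ^ 2 ≤ 1 := by
        rw [← hsum, ← Finset.add_sum_erase S _ hi]
        gcongr
        exact Finset.single_le_sum (f := fun j => a j ^ 2) (fun _ _ => sq_nonneg _) hj
      linarith
    rcases hTi with h | h
    · linarith [hmem.1, hmem.2]
    have h1 : (a j * t) ^ 2 ≤ (π / 2) ^ 2 := by
      calc (a j * t) ^ 2 = a j ^ 2 * t ^ 2 := by ring
        _ ≤ (1 - a i ^ 2) * t ^ 2 := by gcongr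
        _ = (1 / a i ^ 2 - 1) * (a i * t) ^ 2 := by field_simp
        _ ≤ (1 / a i ^ 2 - 1) * T i ^ 2 := by
          have : 0 ≤ 1 / a i ^ 2 - 1 := by
            rw [sub_nonneg, le_div_iff₀ (by positivity)]
            nlinarith [sq_nonneg (a j)]
          have := hmem.2.le
          gcongr
        _ ≤ _ := h
    have h2 := abs_le_of_sq_le_sq h1 (by positivity)
    exact Real.cos_nonneg_of_mem_Icc ⟨by linarith [neg_abs_le (a j * t)],
      (le_abs_self _).trans h2⟩
  · push Not at hex
    have hw := Real.geom_mean_le_arith_mean_weighted S (fun i => a i ^ 2)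
      (fun i => |cos (a i * t)| ^ (1 / a i ^ 2)) (fun _ _ => sq_nonneg _) hsum
      (fun _ _ => by positivity)
    calc ∏ i ∈ S, cos (a i * t) ≤ ∏ i ∈ S, |cos (a i * t)| := by
          rw [← Finset.abs_prod]; exact le_abs_self _
      _ = ∏ i ∈ S, (|cos (a i * t)| ^ (1 / a i ^ 2)) ^ (a i ^ 2) := by
          refine Finset.prod_congr rfl fun i hi => ?_
          have := ha i hi
          rw [← Real.rpow_mul (abs_nonneg _), one_div_mul_cancel (by positivity), Real.rpow_one]
      _ ≤ _ := hw
      _ = _ := by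
          refine Finset.sum_congr rfl fun i hi => ?_
          rw [indicator_of_mem (show a i * t ∈ (Ioo (π / 2) (T i))ᶜ from hex i hi)]

/-- The substitution u = a_i t sends each summand to the one-variable integral from a_i ε. There are
finitely many i, so one small ε serves all; cutting at ε keeps every integral finite. -/
theorem eventually_setIntegral_prod_cos_sub_exp_nonpos {ι : Type*} {S : Finset ι} {a : ι → ℝ}
    (ha : ∀ i ∈ S, 0 < a i) (hsum : ∑ i ∈ S, a i ^ 2 = 1) {p : ℝ} (hp : 2 ≤ p) :
    ∀ᶠ ε in 𝓝[>] (0 : ℝ),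
      ∫ t in Ioi ε, (∏ i ∈ S, cos (a i * t) - exp (-t ^ 2 / 2)) * t ^ (-p - 1) ≤ 0 := by
  have hs (i) (hi : i ∈ S) : 1 ≤ 1 / a i ^ 2 := by
    have h := ha i hi
    rw [le_div_iff₀ (by positivity), one_mul, ← hsum]
    exact Finset.single_le_sum (f := fun j => a j ^ 2) (fun _ _ => sq_nonneg _) hi
  have hex (i) : ∃ T, i ∈ S → π / 2 ≤ T ∧ T < π ∧
      (T = π / 2 ∨ (1 / a i ^ 2 - 1) * T ^ 2 ≤ (π / 2) ^ 2) ∧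
      ∫ u in Ioi T, |cos u| ^ (1 / a i ^ 2) / u ^ 3 < 1 / 12 := by
    by_cases hi : i ∈ S
    · obtain ⟨T, hT⟩ := exists_setIntegral_abs_cos_rpow_lt (hs i hi)
      exact ⟨T, fun _ => hT⟩
    · exact ⟨0, fun h => absurd h hi⟩
  choose T hT using hex
  have hev : ∀ i ∈ S, ∀ᶠ ε in 𝓝[>] (0 : ℝ),
      ∫ u in Ioi (a i * ε), cosSubGauss (1 / a i ^ 2) (T i) u * u ^ (-p - 1) ≤ 0 := by
    intro i hi
    obtain ⟨h1, h2, -, h4⟩ := hT i hi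
    have h := ha i hi
    have := eventually_setIntegral_cosSubGauss_nonpos (by linarith [hs i hi]) h1 h2 h4 hp
    have ht : Tendsto (fun ε : ℝ => a i * ε) (𝓝[>] 0) (𝓝[>] 0) := by
      refine tendsto_nhdsWithin_iff.2 ⟨?_, ?_⟩
      · have : Tendsto (fun ε : ℝ => a i * ε) (𝓝 0) (𝓝 (a i * 0)) := by
          exact (continuous_const.mul continuous_id).tendsto 0
        rw [mul_zero] at this
        exact this.mono_left nhdsWithin_le_nhds
      · filter_upwards [self_mem_nhdsWithin] with ε hε
        exact mul_pos h hε
    exact ht.eventually this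
  filter_upwards [(Filter.eventually_all_finset S).2 hev, self_mem_nhdsWithin] with ε hε h0
  have h0 : 0 < ε := h0
  have hint (i) (hi : i ∈ S) : IntegrableOn (fun t => a i ^ 2 *
      cosSubGauss (1 / a i ^ 2) (T i) (a i * t) * t ^ (-p - 1)) (Ioi ε) := by
    have := ha i hi
    refine integrableOn_Ioi_mul_rpow (C := a i ^ 2 * 2) ?_ (fun u => ?_) h0 (by linarith)
    · exact ((measurable_cosSubGauss _ _).comp (measurable_const_mul _)).const_mul _
    · rw [abs_mul, abs_of_nonneg (sq_nonneg _)]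
      gcongr
      exact abs_cosSubGauss_le (by positivity) _ _
  calc ∫ t in Ioi ε, (∏ i ∈ S, cos (a i * t) - exp (-t ^ 2 / 2)) * t ^ (-p - 1)
      ≤ ∫ t in Ioi ε, ∑ i ∈ S, a i ^ 2 *
          cosSubGauss (1 / a i ^ 2) (T i) (a i * t) * t ^ (-p - 1) := by
        refine setIntegral_mono_on (integrableOn_Ioi_mul_rpow (C := 2) (by fun_prop) (fun u => ?_)
          h0 (by linarith)) (integrable_finsetSum _ hint) measurableSet_Ioi fun t ht => ?_
        · have h1 : |∏ i ∈ S, cos (a i * u)| ≤ 1 := by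
            rw [Finset.abs_prod]
            exact Finset.prod_le_one (fun _ _ => abs_nonneg _) fun _ _ => Real.abs_cos_le_one _
          have h2 : |exp (-u ^ 2 / 2)| ≤ 1 := by
            rw [abs_of_pos (Real.exp_pos _)]
            exact Real.exp_le_one_iff.2 (by nlinarith [sq_nonneg u])
          exact (abs_sub _ _).trans (by linarith)
        · have ht : 0 < t := h0.trans ht
          rw [← Finset.sum_mul]
          gcongr
          exact prod_cos_sub_exp_le ha hsum (fun i hi => ⟨(hT i hi).2.1, (hT i hi).2.2.1⟩) ht
    _ = ∑ i ∈ S, ∫ t in Ioi ε, a i ^ 2 *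
          cosSubGauss (1 / a i ^ 2) (T i) (a i * t) * t ^ (-p - 1) := integral_finsetSum _ hint
    _ ≤ 0 := by
        refine Finset.sum_nonpos fun i hi => ?_
        have h := ha i hi
        have e : ∀ t ∈ Ioi ε, a i ^ 2 * cosSubGauss (1 / a i ^ 2) (T i) (a i * t) * t ^ (-p - 1)
            = (a i ^ 2 * a i ^ (p + 1)) * (fun u => cosSubGauss (1 / a i ^ 2) (T i) u
              * u ^ (-p - 1)) (a i * t) := by
          intro t ht
          have ht : 0 < t := h0.trans ht
          simp only
          rw [Real.mul_rpow h.le ht.le]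
          have : a i ^ (p + 1) * a i ^ (-p - 1) = 1 := by
            rw [← Real.rpow_add h, show p + 1 + (-p - 1) = 0 by ring, Real.rpow_zero]
          linear_combination (-(a i ^ 2 * cosSubGauss (1 / a i ^ 2) (T i) (a i * t)
            * t ^ (-p - 1))) * this
        rw [setIntegral_congr_fun measurableSet_Ioi e, integral_const_mul,
          integral_comp_mul_left_Ioi
            (fun u => cosSubGauss (1 / a i ^ 2) (T i) u * u ^ (-p - 1)) ε h]
        refine mul_nonpos_of_nonneg_of_nonpos (by positivity) ?_
        exact mul_nonpos_of_nonneg_of_nonpos (by positivity) (hε i hi)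

/-! ### Absolute moments as cosine integrals. -/

theorem cos_sub_one_add_nonneg (u : ℝ) : 0 ≤ cos u - 1 + u ^ 2 / 2 := by
  linarith [Real.one_sub_sq_div_two_le_cos (x := u)]

/-- The bracket is O(u⁴) at the origin and O(u²) at infinity, whence the range 2 < p < 4. -/
theorem integrableOn_cos_sub_one_add_mul_rpow {p : ℝ} (hp : 2 < p) (hp' : p < 4) :
    IntegrableOn (fun u => (cos u - 1 + u ^ 2 / 2) * u ^ (-p - 1)) (Ioi 0) := by
  have hm : Measurable fun u : ℝ => (cos u - 1 + u ^ 2 / 2) * u ^ (-p - 1) := by fun_prop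
  rw [← Ioc_union_Ioi_eq_Ioi zero_le_one]
  refine IntegrableOn.union ?_ ?_
  · have h1 : IntegrableOn (fun u : ℝ => u ^ (3 - p)) (Ioc 0 1) := by
      rw [← intervalIntegrable_iff_integrableOn_Ioc_of_le zero_le_one]
      exact intervalIntegral.intervalIntegrable_rpow' (by linarith)
    refine Integrable.mono' h1 hm.aestronglyMeasurable ?_
    refine (ae_restrict_iff' measurableSet_Ioc).2 (Eventually.of_forall fun u hu => ?_)
    have hu0 : 0 < u := hu.1
    have h2 := cos_le_one_sub_add hu0.le
    rw [Real.norm_eq_abs, abs_of_nonneg (mul_nonneg (cos_sub_one_add_nonneg u) (by positivity))]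
    calc (cos u - 1 + u ^ 2 / 2) * u ^ (-p - 1) ≤ u ^ 4 * u ^ (-p - 1) := by
          gcongr
          nlinarith [pow_pos hu0 4]
      _ = u ^ (3 - p) := by
          rw [← Real.rpow_natCast u 4, ← Real.rpow_add hu0]
          congr 1
          push_cast
          ring
  · have h1 : IntegrableOn (fun u : ℝ => u ^ (1 - p)) (Ioi 1) :=
      integrableOn_Ioi_rpow_of_lt (by linarith) zero_lt_one
    refine Integrable.mono' h1 hm.aestronglyMeasurable ?_
    refine (ae_restrict_iff' measurableSet_Ioi).2 (Eventually.of_forall fun u hu => ?_)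
    have hu0 : 0 < u := zero_lt_one.trans hu
    rw [Real.norm_eq_abs, abs_of_nonneg (mul_nonneg (cos_sub_one_add_nonneg u) (by positivity))]
    calc (cos u - 1 + u ^ 2 / 2) * u ^ (-p - 1) ≤ u ^ 2 * u ^ (-p - 1) := by
          gcongr
          nlinarith [Real.cos_le_one u, sq_nonneg u]
      _ = u ^ (1 - p) := by
          rw [← Real.rpow_natCast u 2, ← Real.rpow_add hu0]
          congr 1
          push_cast
          ring

theorem setIntegral_cos_sub_one_add_pos {p : ℝ} (hp : 2 < p) (hp' : p < 4) :
    0 < ∫ u in Ioi (0 : ℝ), (cos u - 1 + u ^ 2 / 2) * u ^ (-p - 1) := by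
  rw [setIntegral_pos_iff_support_of_nonneg_ae _ (integrableOn_cos_sub_one_add_mul_rpow hp hp')]
  · have : Ioi (3 : ℝ) ⊆ (Function.support fun u : ℝ => (cos u - 1 + u ^ 2 / 2) * u ^ (-p - 1))
        ∩ Ioi 0 := by
      intro u hu
      have hu : 3 < u := hu
      have hu0 : 0 < u := by linarith
      refine ⟨(mul_pos ?_ (by positivity)).ne', hu0⟩
      nlinarith [Real.neg_one_le_cos u]
    exact lt_of_lt_of_le (by simp) (measure_mono this)
  · refine (ae_restrict_iff' measurableSet_Ioi).2 (Eventually.of_forall fun u hu => ?_)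
    have hu : 0 < u := hu
    exact mul_nonneg (cos_sub_one_add_nonneg u) (by positivity)

theorem cos_scaling_eq {p x : ℝ} (hx : 0 < x) {t : ℝ} (ht : 0 < t) :
    (cos (x * t) - 1 + x ^ 2 * t ^ 2 / 2) * t ^ (-p - 1) =
      x ^ (p + 1) * ((cos (x * t) - 1 + (x * t) ^ 2 / 2) * (x * t) ^ (-p - 1)) := by
  rw [Real.mul_rpow hx.le ht.le]
  have : x ^ (p + 1) * x ^ (-p - 1) = 1 := by
    rw [← Real.rpow_add hx, show p + 1 + (-p - 1) = 0 by ring, Real.rpow_zero]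
  linear_combination (-((cos (x * t) - 1 + x ^ 2 * t ^ 2 / 2) * t ^ (-p - 1))) * this

theorem integrableOn_cos_mul_sub_one_add {p : ℝ} (hp : 2 < p) (hp' : p < 4) (x : ℝ) :
    IntegrableOn (fun t => (cos (x * t) - 1 + x ^ 2 * t ^ 2 / 2) * t ^ (-p - 1)) (Ioi 0) := by
  wlog hx : 0 ≤ x generalizing x
  · simpa [neg_mul, Real.cos_neg] using this (-x) (by linarith)
  rcases hx.eq_or_lt with rfl | hx
  · simp
  have h := (integrableOn_Ioi_comp_mul_left_iff
    (fun u : ℝ => (cos u - 1 + u ^ 2 / 2) * u ^ (-p - 1)) 0 hx).2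
    (by simpa using integrableOn_cos_sub_one_add_mul_rpow hp hp')
  exact (IntegrableOn.congr_fun (Integrable.const_mul h (x ^ (p + 1)))
    (fun t ht => (cos_scaling_eq hx ht).symm) measurableSet_Ioi)

/-- The absolute moments of order `2 < p < 4` in terms of cosines. -/
theorem setIntegral_cos_mul_sub_one_add {p : ℝ} (hp : 2 < p) (x : ℝ) :
    ∫ t in Ioi (0 : ℝ), (cos (x * t) - 1 + x ^ 2 * t ^ 2 / 2) * t ^ (-p - 1) =
      |x| ^ p * ∫ u in Ioi (0 : ℝ), (cos u - 1 + u ^ 2 / 2) * u ^ (-p - 1) := by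
  wlog hx : 0 ≤ x generalizing x
  · simpa [neg_mul, Real.cos_neg] using this (-x) (by linarith)
  rcases hx.eq_or_lt with rfl | hx
  · simp [Real.zero_rpow (by linarith : p ≠ 0)]
  rw [setIntegral_congr_fun measurableSet_Ioi (fun t ht => cos_scaling_eq hx ht),
    integral_const_mul, integral_comp_mul_left_Ioi
      (fun u : ℝ => (cos u - 1 + u ^ 2 / 2) * u ^ (-p - 1)) 0 hx, mul_zero, smul_eq_mul,
    ← mul_assoc, Real.rpow_add_one hx.ne', abs_of_pos hx, mul_inv_cancel_right₀ hx.ne']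

/-- The `p`-th absolute moment of the standard Gaussian. -/
noncomputable def gaussianMoment (p : ℝ) : ℝ := 2 ^ (p / 2) * Real.Gamma ((p + 1) / 2) / √π

theorem gaussianMoment_nonneg {p : ℝ} (hp : 0 ≤ p) : 0 ≤ gaussianMoment p := by
  have := Real.Gamma_pos_of_pos (s := (p + 1) / 2) (by linarith)
  unfold gaussianMoment
  positivity

theorem gaussianMoment_two : gaussianMoment 2 = 1 := by
  have h : Real.Gamma ((2 + 1) / 2) = 1 / 2 * √π := by
    rw [show ((2 : ℝ) + 1) / 2 = 1 / 2 + 1 by norm_num, Real.Gamma_add_one (by norm_num),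
      Real.Gamma_one_half_eq]
  have := Real.sqrt_pos.2 Real.pi_pos
  rw [gaussianMoment, h]
  norm_num
  field_simp

theorem gaussianMoment_eq_mul {p : ℝ} (hp : 2 ≤ p) :
    gaussianMoment p = (p - 1) * gaussianMoment (p - 2) := by
  rw [gaussianMoment, gaussianMoment, show (p + 1) / 2 = (p - 2 + 1) / 2 + 1 by ring,
    Real.Gamma_add_one (by linarith), show p / 2 = (p - 2) / 2 + 1 by ring,
    Real.rpow_add_one (by norm_num)]
  ring

theorem integral_abs_rpow_gaussianReal {p : ℝ} (hp : 0 ≤ p) :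
    ∫ x, |x| ^ p ∂(gaussianReal 0 1) = gaussianMoment p := by
  rw [integral_gaussianReal_eq_integral_smul (by norm_num)]
  have e : ∀ x : ℝ, gaussianPDFReal 0 1 x • |x| ^ p =
      (fun y : ℝ => (√(2 * π))⁻¹ * (y ^ p * exp (-(1 / 2) * y ^ (2 : ℝ)))) |x| := by
    intro x
    simp only [gaussianPDFReal_def, NNReal.coe_one, mul_one, sub_zero, smul_eq_mul]
    rw [Real.rpow_two, sq_abs, show -(1 / 2) * x ^ 2 = -x ^ 2 / 2 by ring]
    ring
  simp_rw [e]
  rw [integral_comp_abs (f := fun y : ℝ => (√(2 * π))⁻¹ * (y ^ p * exp (-(1 / 2) * y ^ (2 : ℝ)))),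
    integral_const_mul, integral_rpow_mul_exp_neg_mul_rpow (by norm_num) (by linarith)
    (by norm_num), gaussianMoment]
  have h1 : (1 / 2 : ℝ) ^ (-(p + 1) / 2) = 2 ^ (p / 2) * √2 := by
    rw [one_div, Real.inv_rpow (by norm_num), ← Real.rpow_neg (by norm_num), Real.sqrt_eq_rpow,
      ← Real.rpow_add (by norm_num)]
    congr 1
    ring
  rw [h1, Real.sqrt_mul (by norm_num)]
  have := Real.sqrt_pos.2 Real.pi_pos
  have := Real.sqrt_pos.2 (show (0 : ℝ) < 2 by norm_num)
  field_simp

theorem integral_cos_mul_gaussianReal (t : ℝ) :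
    ∫ x, cos (x * t) ∂(gaussianReal 0 1) = exp (-t ^ 2 / 2) := by
  have h := charFun_gaussianReal (μ := 0) (v := 1) t
  rw [charFun_apply_real] at h
  have h2 := congrArg Complex.re h
  have hint : Integrable (fun x : ℝ => Complex.exp (t * x * Complex.I)) (gaussianReal 0 1) := by
    refine Integrable.of_bound (C := 1) (by fun_prop) (Eventually.of_forall fun x => ?_)
    rw [show (t * x * Complex.I : ℂ) = ((t * x : ℝ) : ℂ) * Complex.I by push_cast; ring,
      Complex.norm_exp_ofReal_mul_I]
  rw [← RCLike.re_eq_complex_re, ← integral_re hint] at h2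
  have e1 (x : ℝ) : RCLike.re (Complex.exp (t * x * Complex.I)) = cos (x * t) := by
    rw [show (t * x * Complex.I : ℂ) = ((t * x : ℝ) : ℂ) * Complex.I by push_cast; ring,
      RCLike.re_eq_complex_re, Complex.exp_ofReal_mul_I_re, mul_comm]
  simp_rw [e1] at h2
  rw [h2, RCLike.re_eq_complex_re]
  have : (t * (0 : ℝ) * Complex.I - ((1 : NNReal) : ℝ) * t ^ 2 / 2 : ℂ) = ((-t ^ 2 / 2 : ℝ) : ℂ) := by
    push_cast; ring
  rw [this, Complex.exp_ofReal_re]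

theorem integral_sq_gaussianReal : ∫ x, x ^ 2 ∂(gaussianReal 0 1) = 1 := by
  have h := integral_abs_rpow_gaussianReal (p := 2) (by norm_num)
  simpa [gaussianMoment_two] using h

theorem integrable_abs_rpow_gaussianReal {p : ℝ} (hp : 0 < p) :
    Integrable (fun x : ℝ => |x| ^ p) (gaussianReal 0 1) := by
  have := (memLp_id_gaussianReal' (μ := 0) (v := 1) (ENNReal.ofReal p)
    ENNReal.ofReal_ne_top).integrable_norm_rpow (by simpa using hp) ENNReal.ofReal_ne_top
  simpa [ENNReal.toReal_ofReal hp.le] using this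

/-- Fubini: integrate the cosine representation of |x|^p against the standard Gaussian, whose cosine
transform is exp (−t²/2) and whose variance is 1. -/
theorem setIntegral_exp_sub_one_add {p : ℝ} (hp : 2 < p) (hp' : p < 4) :
    IntegrableOn (fun t : ℝ => (exp (-t ^ 2 / 2) - 1 + t ^ 2 / 2) * t ^ (-p - 1)) (Ioi 0) ∧
    ∫ t in Ioi (0 : ℝ), (exp (-t ^ 2 / 2) - 1 + t ^ 2 / 2) * t ^ (-p - 1) =
      gaussianMoment p * ∫ u in Ioi (0 : ℝ), (cos u - 1 + u ^ 2 / 2) * u ^ (-p - 1) := by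
  set f : ℝ → ℝ → ℝ := fun x t => (cos (x * t) - 1 + x ^ 2 * t ^ 2 / 2) * t ^ (-p - 1)
  have hf : Integrable (Function.uncurry f) ((gaussianReal 0 1).prod (volume.restrict (Ioi 0))) := by
    have hm : Measurable (Function.uncurry f) := by
      simp only [f, Function.uncurry_def]
      fun_prop
    rw [integrable_prod_iff hm.aestronglyMeasurable]
    refine ⟨Eventually.of_forall fun x => integrableOn_cos_mul_sub_one_add hp hp' x, ?_⟩
    have e (x : ℝ) : ∫ t in Ioi (0 : ℝ), ‖Function.uncurry f (x, t)‖ =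
        |x| ^ p * ∫ u in Ioi (0 : ℝ), (cos u - 1 + u ^ 2 / 2) * u ^ (-p - 1) := by
      rw [← setIntegral_cos_mul_sub_one_add hp x]
      refine setIntegral_congr_fun measurableSet_Ioi fun t ht => ?_
      have ht : 0 < t := ht
      simp only [Function.uncurry, f]
      rw [Real.norm_eq_abs, abs_of_nonneg]
      refine mul_nonneg ?_ (by positivity)
      simpa [mul_pow] using cos_sub_one_add_nonneg (x * t)
    simp_rw [e]
    exact (integrable_abs_rpow_gaussianReal (by linarith)).mul_const _
  have e (t : ℝ) : ∫ x, f x t ∂(gaussianReal 0 1) =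
      (exp (-t ^ 2 / 2) - 1 + t ^ 2 / 2) * t ^ (-p - 1) := by
    have h1 : Integrable (fun x : ℝ => cos (x * t)) (gaussianReal 0 1) :=
      Integrable.of_bound (C := 1) (by fun_prop)
        (Eventually.of_forall fun x => by simpa using Real.abs_cos_le_one (x * t))
    have h2 : Integrable (fun x : ℝ => x ^ 2 * t ^ 2 / 2) (gaussianReal 0 1) := by
      have := integrable_abs_rpow_gaussianReal (p := 2) (by norm_num)
      simp only [Real.rpow_two, sq_abs] at this
      exact (this.mul_const _).div_const _
    have h3 : Integrable (fun x : ℝ => cos (x * t) - 1) (gaussianReal 0 1) :=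
      h1.sub (integrable_const 1)
    simp only [f]
    rw [integral_mul_const, integral_add h3 h2, integral_sub h1 (integrable_const 1),
      integral_div, integral_mul_const, integral_cos_mul_gaussianReal, integral_sq_gaussianReal]
    simp
  have h1 := hf.integral_prod_right
  simp only [Function.uncurry] at h1
  simp_rw [e] at h1
  refine ⟨h1, ?_⟩
  simp_rw [← e]
  rw [← integral_integral_swap hf]
  simp only [f]
  simp_rw [setIntegral_cos_mul_sub_one_add hp]
  rw [integral_mul_const, integral_abs_rpow_gaussianReal (by linarith)]

/-! ### Averages over signs. -/

section SignMean

variable {ι V : Type*} [DecidableEq ι] [AddCommGroup V]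

/-- The mean of `f (∑ ± y i)` over all choices of signs. -/
noncomputable def signMean (s : Finset ι) (y : ι → V) (f : V → ℝ) : ℝ :=
  (∑ A ∈ s.powerset, f (∑ i ∈ s, if i ∈ A then y i else -y i)) / 2 ^ s.card

theorem signMean_empty (y : ι → V) (f : V → ℝ) : signMean ∅ y f = f 0 := by simp [signMean]

theorem signMean_insert {s : Finset ι} {j : ι} (hj : j ∉ s) (y : ι → V) (f : V → ℝ) :
    signMean (insert j s) y f =
      (signMean s y (fun v => f (v + y j)) + signMean s y (fun v => f (v - y j))) / 2 := by
  have h1 : ∀ A ∈ s.powerset, f (∑ i ∈ insert j s, if i ∈ A then y i else -y i) =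
      f ((∑ i ∈ s, if i ∈ A then y i else -y i) - y j) := by
    intro A hA
    have : j ∉ A := fun h => hj (Finset.mem_powerset.1 hA h)
    rw [Finset.sum_insert hj, if_neg this, neg_add_eq_sub]
  have h2 : ∀ A ∈ s.powerset, f (∑ i ∈ insert j s, if i ∈ insert j A then y i else -y i) =
      f ((∑ i ∈ s, if i ∈ A then y i else -y i) + y j) := by
    intro A hA
    rw [Finset.sum_insert hj, if_pos (Finset.mem_insert_self _ _), add_comm]
    congr 2
    refine Finset.sum_congr rfl fun i hi => ?_
    have : i ≠ j := fun h => hj (h ▸ hi)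
    simp [this]
  simp only [signMean]
  rw [Finset.sum_powerset_insert hj, Finset.sum_congr rfl h1, Finset.sum_congr rfl h2,
    Finset.card_insert_of_notMem hj, pow_succ]
  field_simp
  ring

theorem signMean_mono (s : Finset ι) (y : ι → V) {f g : V → ℝ} (h : ∀ v, f v ≤ g v) :
    signMean s y f ≤ signMean s y g := by
  unfold signMean
  gcongr
  exact h _

theorem signMean_const (s : Finset ι) (y : ι → V) (c : ℝ) : signMean s y (fun _ => c) = c := by
  simp [signMean, Finset.card_powerset]

theorem signMean_add (s : Finset ι) (y : ι → V) (f g : V → ℝ) :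
    signMean s y (fun v => f v + g v) = signMean s y f + signMean s y g := by
  simp [signMean, Finset.sum_add_distrib, add_div]

theorem signMean_sub (s : Finset ι) (y : ι → V) (f g : V → ℝ) :
    signMean s y (fun v => f v - g v) = signMean s y f - signMean s y g := by
  simp [signMean, Finset.sum_sub_distrib, sub_div]

theorem signMean_const_mul (s : Finset ι) (y : ι → V) (c : ℝ) (f : V → ℝ) :
    signMean s y (fun v => c * f v) = c * signMean s y f := by
  rw [signMean, signMean, ← Finset.mul_sum, mul_div_assoc]

theorem signMean_nonneg (s : Finset ι) (y : ι → V) {f : V → ℝ} (h : ∀ v, 0 ≤ f v) :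
    0 ≤ signMean s y f := by
  simpa [signMean_const] using signMean_mono s y h

theorem signMean_map {W : Type*} [AddCommGroup W] (s : Finset ι) (y : ι → V) (L : V →+ W)
    (f : W → ℝ) : signMean s (fun i => L (y i)) f = signMean s y (fun v => f (L v)) := by
  simp only [signMean, map_sum]
  congr 1
  refine Finset.sum_congr rfl fun A _ => ?_
  congr 1
  refine Finset.sum_congr rfl fun i _ => ?_
  split_ifs <;> simp

theorem signMean_integral {α : Type*} [MeasurableSpace α] {μ : Measure α} (s : Finset ι) (y : ι → V)
    {F : V → α → ℝ} (hF : ∀ v, Integrable (F v) μ) :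
    signMean s y (fun v => ∫ t, F v t ∂μ) = ∫ t, signMean s y (fun v => F v t) ∂μ := by
  simp only [signMean]
  rw [integral_div, integral_finsetSum _ fun A _ => hF _]

theorem integrable_signMean {α : Type*} [MeasurableSpace α] {μ : Measure α} (s : Finset ι)
    (y : ι → V) {F : V → α → ℝ} (hF : ∀ v, Integrable (F v) μ) :
    Integrable (fun t => signMean s y (fun v => F v t)) μ := by
  simp only [signMean]
  exact (integrable_finsetSum _ fun A _ => hF _).div_const _

end SignMean

theorem prod_cos_eq_prod_filter {ι : Type*} (s : Finset ι) (a : ι → ℝ) (t : ℝ) :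
    ∏ i ∈ s, cos (a i * t) = ∏ i ∈ s with a i ≠ 0, cos (|a i| * t) := by
  rw [Finset.prod_filter_of_ne]
  · refine Finset.prod_congr rfl fun i _ => ?_
    rcases abs_choice (a i) with h | h <;> simp [h, Real.cos_neg]
  · intro i _ h hi
    exact h (by simp [hi])

/-- Vanishing coefficients and signs do not affect the product, so all a_i may be taken positive;
the cut-off is then removed along ε = 1/(n + 1). -/
theorem setIntegral_prod_cos_sub_exp_nonpos {ι : Type*} {s : Finset ι} {a : ι → ℝ}
    (hsum : ∑ i ∈ s, a i ^ 2 = 1) {p : ℝ} (hp : 2 ≤ p)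
    (hint : IntegrableOn (fun t => (∏ i ∈ s, cos (a i * t) - exp (-t ^ 2 / 2)) * t ^ (-p - 1))
      (Ioi 0)) :
    ∫ t in Ioi 0, (∏ i ∈ s, cos (a i * t) - exp (-t ^ 2 / 2)) * t ^ (-p - 1) ≤ 0 := by
  have hsum' : ∑ i ∈ s with a i ≠ 0, |a i| ^ 2 = 1 := by
    rw [← hsum, Finset.sum_filter_of_ne]
    · simp
    · intro i _ h hi
      exact h (by simp [hi])
  have hev := eventually_setIntegral_prod_cos_sub_exp_nonpos (S := s.filter fun i => a i ≠ 0)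
    (a := fun i => |a i|) (fun i hi => abs_pos.2 (Finset.mem_filter.1 hi).2) hsum' hp
  simp_rw [← prod_cos_eq_prod_filter] at hev
  have hu : ⋃ n : ℕ, Ioi (1 / ((n : ℝ) + 1)) = Ioi 0 := by
    ext x
    simp only [mem_iUnion, mem_Ioi]
    exact ⟨fun ⟨n, hn⟩ => lt_trans (by positivity) hn, fun hx => exists_nat_one_div_lt hx⟩
  have hlim := tendsto_setIntegral_of_monotone (μ := volume)
    (f := fun t => (∏ i ∈ s, cos (a i * t) - exp (-t ^ 2 / 2)) * t ^ (-p - 1))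
    (s := fun n : ℕ => Ioi (1 / ((n : ℝ) + 1))) (fun _ => measurableSet_Ioi)
    (fun m n hmn => Ioi_subset_Ioi (by gcongr)) (by rwa [hu])
  rw [hu] at hlim
  refine le_of_tendsto hlim ?_
  refine Tendsto.eventually (tendsto_nhdsWithin_iff.2 ⟨tendsto_one_div_add_atTop_nhds_zero_nat,
    Eventually.of_forall fun n => ?_⟩) hev
  show (0 : ℝ) < 1 / ((n : ℝ) + 1)
  positivity

/-! ### Khintchine's inequality with the Gaussian constant. -/

section Khintchine

variable {ι : Type*} [DecidableEq ι]

theorem signMean_cos (s : Finset ι) (a : ι → ℝ) (t : ℝ) :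
    signMean s a (fun v => cos (v * t)) = ∏ i ∈ s, cos (a i * t) := by
  induction s using Finset.induction_on with
  | empty => simp [signMean_empty]
  | insert j s hj ih =>
    rw [signMean_insert hj, Finset.prod_insert hj, ← ih, ← signMean_add, ← signMean_const_mul,
      div_eq_inv_mul, ← signMean_const_mul]
    congr 1
    funext v
    rw [add_mul, sub_mul, Real.cos_add, Real.cos_sub]
    ring

theorem signMean_sq (s : Finset ι) (a : ι → ℝ) :
    signMean s a (fun v => v ^ 2) = ∑ i ∈ s, a i ^ 2 := by
  induction s using Finset.induction_on with
  | empty => simp [signMean_empty]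
  | insert j s hj ih =>
    rw [signMean_insert hj, Finset.sum_insert hj, ← ih, ← signMean_add, div_eq_inv_mul,
      ← signMean_const_mul]
    have : (fun v => 2⁻¹ * ((v + a j) ^ 2 + (v - a j) ^ 2)) = fun v => a j ^ 2 + v ^ 2 := by
      funext v; ring
    rw [this, signMean_add, signMean_const]

/-- Both sides, times the same positive constant, are integrals of a function minus 1 − t²/2 against
t^(−p−1): the product of cosines on the left, exp (−t²/2) on the right. The quadratic terms cancel
because both variances are 1. -/
theorem signMean_abs_rpow_le_of_lt_four_of_sum_eq_one {p : ℝ} (hp : 2 < p) (hp' : p < 4)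
    (s : Finset ι) (a : ι → ℝ) (hsum : ∑ i ∈ s, a i ^ 2 = 1) :
    signMean s a (fun v => |v| ^ p) ≤ gaussianMoment p := by
  have hK := setIntegral_cos_sub_one_add_pos hp hp'
  refine le_of_mul_le_mul_right ?_ hK
  obtain ⟨h1, h2⟩ := setIntegral_exp_sub_one_add hp hp'
  have hF := fun v => integrableOn_cos_mul_sub_one_add hp hp' v
  have e : signMean s a (fun v => |v| ^ p) *
      (∫ u in Ioi (0 : ℝ), (cos u - 1 + u ^ 2 / 2) * u ^ (-p - 1)) =
      ∫ t in Ioi (0 : ℝ), (∏ i ∈ s, cos (a i * t) - 1 + t ^ 2 / 2) * t ^ (-p - 1) := by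
    rw [mul_comm, ← signMean_const_mul]
    simp_rw [mul_comm (∫ u in Ioi (0 : ℝ), (cos u - 1 + u ^ 2 / 2) * u ^ (-p - 1)),
      ← setIntegral_cos_mul_sub_one_add hp]
    rw [signMean_integral s a hF]
    congr 1
    funext t
    have : (fun v : ℝ => (cos (v * t) - 1 + v ^ 2 * t ^ 2 / 2) * t ^ (-p - 1)) = fun v =>
        t ^ (-p - 1) * (cos (v * t) - 1 + t ^ 2 / 2 * v ^ 2) := by
      funext v; ring
    rw [this, signMean_const_mul, signMean_add, signMean_sub, signMean_const, signMean_cos,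
      signMean_const_mul, signMean_sq, hsum]
    ring
  have hi : IntegrableOn (fun t => (∏ i ∈ s, cos (a i * t) - 1 + t ^ 2 / 2) * t ^ (-p - 1))
      (Ioi 0) := by
    have := integrable_signMean s a hF
    refine this.congr (Eventually.of_forall fun t => ?_)
    have : (fun v : ℝ => (cos (v * t) - 1 + v ^ 2 * t ^ 2 / 2) * t ^ (-p - 1)) = fun v =>
        t ^ (-p - 1) * (cos (v * t) - 1 + t ^ 2 / 2 * v ^ 2) := by
      funext v; ring
    simp only
    rw [this, signMean_const_mul, signMean_add, signMean_sub, signMean_const, signMean_cos,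
      signMean_const_mul, signMean_sq, hsum]
    ring
  have e3 : (fun t => (∏ i ∈ s, cos (a i * t) - exp (-t ^ 2 / 2)) * t ^ (-p - 1)) =
      fun t => (∏ i ∈ s, cos (a i * t) - 1 + t ^ 2 / 2) * t ^ (-p - 1)
        - (exp (-t ^ 2 / 2) - 1 + t ^ 2 / 2) * t ^ (-p - 1) := by
    funext t
    ring
  have e4 := setIntegral_prod_cos_sub_exp_nonpos hsum hp.le (e3 ▸ hi.sub h1)
  rw [e3, integral_sub hi h1] at e4
  rw [e, ← h2]
  linarith

theorem signMean_abs_rpow_le_of_lt_four {p : ℝ} (hp : 2 ≤ p) (hp' : p < 4)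
    (s : Finset ι) (a : ι → ℝ) :
    signMean s a (fun v => |v| ^ p) ≤ gaussianMoment p * (∑ i ∈ s, a i ^ 2) ^ (p / 2) := by
  rcases hp.eq_or_lt with rfl | hp
  · have := signMean_sq s a
    simp [gaussianMoment_two, this]
  obtain ⟨σ, hσ0, hσ⟩ : ∃ σ, 0 ≤ σ ∧ σ ^ 2 = ∑ i ∈ s, a i ^ 2 :=
    ⟨√(∑ i ∈ s, a i ^ 2), Real.sqrt_nonneg _, Real.sq_sqrt (Finset.sum_nonneg fun _ _ => sq_nonneg _)⟩
  have hσp : (∑ i ∈ s, a i ^ 2) ^ (p / 2) = σ ^ p := by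
    rw [← hσ, ← Real.rpow_natCast_mul hσ0]
    congr 1
    push_cast
    ring
  rw [hσp]
  rcases hσ0.eq_or_lt with rfl | hσ0
  · have h0 : ∀ i ∈ s, a i = 0 := by
      have := (Finset.sum_eq_zero_iff_of_nonneg (fun i _ => sq_nonneg (a i))).1
        (hσ.symm.trans (by norm_num))
      exact fun i hi => by simpa using this i hi
    have : signMean s a (fun v => |v| ^ p) = 0 := by
      have h1 (A : Finset ι) : ∑ i ∈ s, (if i ∈ A then a i else -a i) = 0 :=
        Finset.sum_eq_zero fun i hi => by simp [h0 i hi]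
      simp [signMean, h1, Real.zero_rpow (by linarith : p ≠ 0)]
    rw [this]
    exact mul_nonneg (gaussianMoment_nonneg (by linarith)) (by positivity)
  have h := signMean_abs_rpow_le_of_lt_four_of_sum_eq_one hp hp' s (fun i => σ⁻¹ * a i) (by
    simp only [mul_pow]
    rw [← Finset.mul_sum, ← hσ]
    field_simp)
  have e : signMean s (fun i => σ⁻¹ * a i) (fun v => |v| ^ p) =
      (σ ^ p)⁻¹ * signMean s a (fun v => |v| ^ p) := by
    rw [← signMean_const_mul]
    refine (signMean_map s a (AddMonoidHom.mulLeft σ⁻¹) (fun v => |v| ^ p)).trans ?_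
    congr 1
    funext v
    rw [AddMonoidHom.coe_mulLeft, abs_mul, abs_of_pos (by positivity : 0 < σ⁻¹),
      Real.mul_rpow (by positivity) (abs_nonneg _), Real.inv_rpow hσ0.le]
  rw [e, inv_mul_le_iff₀ (by positivity)] at h
  linarith

/-- An even convex function of t is nondecreasing for t ≥ 0; concretely, w ± t are convex
combinations of w + a and w − a with weights (1 ± t/a)/2. -/
theorem abs_rpow_add_abs_rpow_le {q w a t : ℝ} (hq : 1 ≤ q) (ht : 0 ≤ t) (hta : t ≤ a) :
    |w + t| ^ q + |w - t| ^ q ≤ |w + a| ^ q + |w - a| ^ q := by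
  rcases ht.eq_or_lt with rfl | ht
  · rw [add_zero, sub_zero]
    have h1 : |w| ≤ (1 / 2) * |w + a| + (1 / 2) * |w - a| := by
      calc |w| = |(1 / 2) * (w + a) + (1 / 2) * (w - a)| := by congr 1; ring
        _ ≤ _ := (abs_add_le _ _).trans (by simp [abs_mul])
    have h2 := (convexOn_rpow hq).2 (abs_nonneg (w + a)) (abs_nonneg (w - a))
      (by norm_num : (0 : ℝ) ≤ 1 / 2) (by norm_num : (0 : ℝ) ≤ 1 / 2) (by norm_num)
    simp only [smul_eq_mul] at h2
    have h3 := Real.rpow_le_rpow (abs_nonneg _) h1 (by linarith : 0 ≤ q)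
    linarith
  have ha : 0 < a := ht.trans_le hta
  set l := (1 + t / a) / 2 with hl
  have hta' : t / a ≤ 1 := (div_le_one ha).2 hta
  have h0 : 0 ≤ t / a := by positivity
  have hl0 : 0 ≤ l := by rw [hl]; linarith
  have hl1 : 0 ≤ 1 - l := by rw [hl]; linarith
  have hla : a * (2 * l - 1) = t := by rw [hl]; field_simp; ring
  have h1 : |w + t| ≤ l * |w + a| + (1 - l) * |w - a| := by
    calc |w + t| = |l * (w + a) + (1 - l) * (w - a)| := by
          congr 1; linear_combination -hla
      _ ≤ _ := (abs_add_le _ _).trans (by simp [abs_mul, abs_of_nonneg hl0, abs_of_nonneg hl1])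
  have h2 : |w - t| ≤ (1 - l) * |w + a| + l * |w - a| := by
    calc |w - t| = |(1 - l) * (w + a) + l * (w - a)| := by
          congr 1; linear_combination hla
      _ ≤ _ := (abs_add_le _ _).trans (by simp [abs_mul, abs_of_nonneg hl0, abs_of_nonneg hl1])
  have c1 := (convexOn_rpow hq).2 (abs_nonneg (w + a)) (abs_nonneg (w - a)) hl0 hl1 (by ring)
  have c2 := (convexOn_rpow hq).2 (abs_nonneg (w + a)) (abs_nonneg (w - a)) hl1 hl0 (by ring)
  simp only [smul_eq_mul] at c1 c2
  have d1 := Real.rpow_le_rpow (abs_nonneg _) h1 (by linarith : 0 ≤ q)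
  have d2 := Real.rpow_le_rpow (abs_nonneg _) h2 (by linarith : 0 ≤ q)
  linarith

theorem hasDerivAt_mul_abs_rpow {q : ℝ} (hq : 1 < q) (x : ℝ) :
    HasDerivAt (fun v : ℝ => v * |v| ^ q) ((q + 1) * |x| ^ q) x := by
  refine ((hasDerivAt_id x).mul (hasDerivAt_abs_rpow x hq)).congr_deriv ?_
  rcases eq_or_ne x 0 with rfl | hx
  · simp [Real.zero_rpow (by linarith : q ≠ 0)]
  · have : |x| ^ q = |x| ^ (q - 2) * x ^ 2 := by
      rw [← sq_abs x, ← Real.rpow_natCast, ← Real.rpow_add (abs_pos.2 hx)]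
      congr 1; push_cast; ring
    simp only [id]
    rw [this]; ring

/-- Trapezoid rule for the convex function `v ↦ |v| ^ q`. -/
theorem trapezoid_abs_rpow {q : ℝ} (hq : 1 < q) (w a : ℝ) :
    a * ((w + a) * |w + a| ^ q - (w - a) * |w - a| ^ q) ≤
      (q + 1) * a ^ 2 * (|w + a| ^ q + |w - a| ^ q) := by
  wlog ha : 0 ≤ a generalizing a
  · have := this (-a) (by linarith)
    simp only [sub_neg_eq_add, ← sub_eq_add_neg] at this
    linarith
  have hd (t : ℝ) : HasDerivAt (fun t : ℝ => t * ((q + 1) * (|w + a| ^ q + |w - a| ^ q))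
      - ((w + t) * |w + t| ^ q - (w - t) * |w - t| ^ q))
      ((q + 1) * (|w + a| ^ q + |w - a| ^ q) - ((q + 1) * |w + t| ^ q + (q + 1) * |w - t| ^ q)) t := by
    have h1 := (hasDerivAt_mul_abs_rpow hq (w + t)).comp t ((hasDerivAt_id t).const_add w)
    have h2 := (hasDerivAt_mul_abs_rpow hq (w - t)).comp t ((hasDerivAt_id t).const_sub w)
    refine ((((hasDerivAt_id t).mul_const _).sub (h1.sub h2))).congr_deriv ?_
    ring
  have hm := monotoneOn_of_deriv_nonneg (convex_Icc 0 a)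
    (fun t _ => (hd t).continuousAt.continuousWithinAt)
    (fun t _ => (hd t).differentiableAt.differentiableWithinAt) (fun t ht => by
      rw [interior_Icc] at ht
      rw [(hd t).deriv]
      have := mul_le_mul_of_nonneg_left (abs_rpow_add_abs_rpow_le (w := w) hq.le ht.1.le ht.2.le)
        (by linarith : 0 ≤ q + 1)
      linarith)
  have := hm (left_mem_Icc.2 ha) (right_mem_Icc.2 ha) ha
  simp only [zero_mul, add_zero, sub_zero, sub_self] at this
  nlinarith

/-- A discrete form of the Gaussian identity E[g f(g)] = σ² E[f'(g)] for f(v) = (v + c) |v + c|^q.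
Splitting off one sign moves c by ± a_j, so the induction needs all c; the term carrying the factor
± a_j is controlled by the trapezoid rule. -/
theorem signMean_mul_le (s : Finset ι) (a : ι → ℝ) {q : ℝ} (hq : 1 < q) (c : ℝ) :
    signMean s a (fun v => v * ((v + c) * |v + c| ^ q)) ≤
      (q + 1) * (∑ i ∈ s, a i ^ 2) * signMean s a (fun v => |v + c| ^ q) := by
  induction s using Finset.induction_on generalizing c with
  | empty => simp [signMean_empty]
  | insert j s hj ih =>
    rw [signMean_insert hj, signMean_insert hj, Finset.sum_insert hj]
    have i1 := ih (a j + c)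
    have i2 := ih (c - a j)
    have i3 : signMean s a (fun v => a j * ((v + (a j + c)) * |v + (a j + c)| ^ q) -
        a j * ((v + (c - a j)) * |v + (c - a j)| ^ q)) ≤ signMean s a (fun v =>
        (q + 1) * a j ^ 2 * (|v + (a j + c)| ^ q) + (q + 1) * a j ^ 2 * |v + (c - a j)| ^ q) := by
      refine signMean_mono s a fun v => ?_
      have := trapezoid_abs_rpow hq (v + c) (a j)
      rw [show v + c + a j = v + (a j + c) by ring, show v + c - a j = v + (c - a j) by ring] at this
      linarith
    rw [signMean_add, signMean_sub, signMean_const_mul, signMean_const_mul, signMean_const_mul,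
      signMean_const_mul] at i3
    have e1 : signMean s a (fun v => (v + a j) * ((v + a j + c) * |v + a j + c| ^ q)) =
        signMean s a (fun v => v * ((v + (a j + c)) * |v + (a j + c)| ^ q)) +
        a j * signMean s a (fun v => (v + (a j + c)) * |v + (a j + c)| ^ q) := by
      rw [← signMean_const_mul, ← signMean_add]
      congr 1; funext v; rw [← add_assoc]; ring
    have e2 : signMean s a (fun v => (v - a j) * ((v - a j + c) * |v - a j + c| ^ q)) =
        signMean s a (fun v => v * ((v + (c - a j)) * |v + (c - a j)| ^ q)) -
        a j * signMean s a (fun v => (v + (c - a j)) * |v + (c - a j)| ^ q) := by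
      rw [← signMean_const_mul, ← signMean_sub]
      congr 1; funext v; rw [show v - a j + c = v + (c - a j) by ring]; ring
    have e3 : (fun v : ℝ => |v + a j + c| ^ q) = fun v => |v + (a j + c)| ^ q := by
      funext v; rw [add_assoc]
    have e4 : (fun v : ℝ => |v - a j + c| ^ q) = fun v => |v + (c - a j)| ^ q := by
      funext v; rw [show v - a j + c = v + (c - a j) by ring]
    rw [e1, e2, e3, e4]
    linarith

/-- **Khintchine's inequality** with the best constant, for `2 ≤ p`. -/
theorem signMean_abs_rpow_le {p : ℝ} (hp : 2 ≤ p) (s : Finset ι) (a : ι → ℝ) :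
    signMean s a (fun v => |v| ^ p) ≤ gaussianMoment p * (∑ i ∈ s, a i ^ 2) ^ (p / 2) := by
  obtain ⟨n, hn⟩ : ∃ n : ℕ, p < 4 + 2 * n := by
    obtain ⟨n, hn⟩ := exists_nat_gt p
    exact ⟨n, by have : (0 : ℝ) ≤ n := n.cast_nonneg; linarith⟩
  induction n generalizing p with
  | zero => exact signMean_abs_rpow_le_of_lt_four hp (by simpa using hn) s a
  | succ n ih =>
    rcases lt_or_ge p 4 with h4 | h4
    · exact signMean_abs_rpow_le_of_lt_four hp h4 s a
    have h := ih (p := p - 2) (by linarith) (by push_cast at hn; linarith)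
    -- With q = p − 2 the factor q + 1 is p − 1, exactly the ratio of the Gaussian moments of orders
    -- p and p − 2.
    have h1 := signMean_mul_le s a (q := p - 2) (by linarith) 0
    simp only [add_zero] at h1
    have e1 : (fun v : ℝ => v * (v * |v| ^ (p - 2))) = fun v => |v| ^ p := by
      funext v
      rw [← mul_assoc, ← sq, ← sq_abs, ← Real.rpow_natCast, ← Real.rpow_add_of_nonneg
        (abs_nonneg v) (by norm_num) (by linarith)]
      congr 1; push_cast; ring
    rw [e1] at h1
    have hσ : 0 ≤ ∑ i ∈ s, a i ^ 2 := Finset.sum_nonneg fun _ _ => sq_nonneg _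
    have e2 : (∑ i ∈ s, a i ^ 2) ^ (p / 2) =
        (∑ i ∈ s, a i ^ 2) * (∑ i ∈ s, a i ^ 2) ^ ((p - 2) / 2) := by
      rw [← Real.rpow_one_add' hσ (by linarith)]
      congr 1; ring
    rw [gaussianMoment_eq_mul hp, e2]
    have h2 : 0 ≤ (p - 2 + 1) * ∑ i ∈ s, a i ^ 2 := mul_nonneg (by linarith) hσ
    have := mul_le_mul_of_nonneg_left h h2
    linarith

end Khintchine

/-! ### Type estimates in ℓ_p. -/

section Averages

variable {ι : Type*} [DecidableEq ι]

theorem le_signMean {V : Type*} [AddCommGroup V] {s : Finset ι} {y : ι → V} {f : V → ℝ} {c : ℝ}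
    (h : ∀ A ⊆ s, c ≤ f (∑ i ∈ s, if i ∈ A then y i else -y i)) : c ≤ signMean s y f := by
  rw [signMean, le_div_iff₀ (by positivity)]
  calc c * 2 ^ s.card = ∑ _A ∈ s.powerset, c := by simp [Finset.card_powerset, mul_comm]
    _ ≤ _ := Finset.sum_le_sum fun A hA => h A (Finset.mem_powerset.1 hA)

/-- The parallelogram law between concavity and subadditivity of x ↦ x^(p/2). -/
theorem norm_add_rpow_add_norm_sub_rpow_le {𝕜 : Type*} [RCLike 𝕜] {p : ℝ} (hp : 0 < p) (hp2 : p ≤ 2)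
    (v a : 𝕜) : (‖v + a‖ ^ p + ‖v - a‖ ^ p) / 2 ≤ ‖v‖ ^ p + ‖a‖ ^ p := by
  have e (x : 𝕜) : ‖x‖ ^ p = (‖x‖ ^ 2) ^ (p / 2) := by
    rw [← Real.rpow_natCast_mul (norm_nonneg _)]
    congr 1; push_cast; ring
  have h1 := (Real.concaveOn_rpow (p := p / 2) (by positivity) (by linarith)).2
    (sq_nonneg ‖v + a‖) (sq_nonneg ‖v - a‖)
    (by norm_num : (0 : ℝ) ≤ 1 / 2) (by norm_num : (0 : ℝ) ≤ 1 / 2) (by norm_num)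
  have h2 := parallelogram_law_with_norm 𝕜 v a
  have h3 := Real.rpow_add_le_add_rpow (sq_nonneg ‖v‖) (sq_nonneg ‖a‖)
    (by positivity : 0 ≤ p / 2) (by linarith)
  simp only [smul_eq_mul] at h1
  rw [show 1 / 2 * ‖v + a‖ ^ 2 + 1 / 2 * ‖v - a‖ ^ 2 = ‖v‖ ^ 2 + ‖a‖ ^ 2 by linarith] at h1
  rw [e, e, e, e]
  linarith

theorem signMean_norm_rpow_le_sum {𝕜 : Type*} [RCLike 𝕜] {p : ℝ} (hp : 0 < p) (hp2 : p ≤ 2)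
    (s : Finset ι) (a : ι → 𝕜) : signMean s a (fun v => ‖v‖ ^ p) ≤ ∑ i ∈ s, ‖a i‖ ^ p := by
  induction s using Finset.induction_on with
  | empty => simp [signMean_empty, Real.zero_rpow hp.ne']
  | insert j s hj ih =>
    rw [signMean_insert hj, Finset.sum_insert hj, ← signMean_add, div_eq_inv_mul,
      ← signMean_const_mul]
    calc _ ≤ signMean s a (fun v => ‖a j‖ ^ p + ‖v‖ ^ p) := signMean_mono _ _ fun v => by
          linarith [norm_add_rpow_add_norm_sub_rpow_le hp hp2 v (a j)]
      _ ≤ _ := by rw [signMean_add, signMean_const]; gcongr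

/-- Minkowski's inequality for means over signs. -/
theorem signMean_add_rpow_le {V : Type*} [AddCommGroup V] (s : Finset ι) (y : ι → V) {f g : V → ℝ}
    (hf : ∀ v, 0 ≤ f v) (hg : ∀ v, 0 ≤ g v) {r : ℝ} (hr : 1 ≤ r) :
    signMean s y (fun v => (f v + g v) ^ r) ^ (1 / r) ≤
      signMean s y (fun v => f v ^ r) ^ (1 / r) + signMean s y (fun v => g v ^ r) ^ (1 / r) := by
  simp only [signMean]
  have h := Real.Lp_add_le_of_nonneg s.powerset
    (f := fun A => f (∑ i ∈ s, if i ∈ A then y i else -y i))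
    (g := fun A => g (∑ i ∈ s, if i ∈ A then y i else -y i)) hr (fun _ _ => hf _) fun _ _ => hg _
  have hn {F : V → ℝ} (hF : ∀ v, 0 ≤ F v) :
      0 ≤ ∑ A ∈ s.powerset, F (∑ i ∈ s, if i ∈ A then y i else -y i) ^ r :=
    Finset.sum_nonneg fun _ _ => Real.rpow_nonneg (hF _) _
  rw [Real.div_rpow (hn hf) (by positivity), Real.div_rpow (hn hg) (by positivity),
    Real.div_rpow (hn fun v => add_nonneg (hf v) (hg v)) (by positivity), ← add_div]
  gcongr

/-- Khintchine's inequality for real or complex scalars. -/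
theorem signMean_norm_rpow_le {𝕜 : Type*} [RCLike 𝕜] {p : ℝ} (hp : 2 ≤ p) (s : Finset ι)
    (a : ι → 𝕜) :
    signMean s a (fun v => ‖v‖ ^ p) ≤ gaussianMoment p * (∑ i ∈ s, ‖a i‖ ^ 2) ^ (p / 2) := by
  have hγ := gaussianMoment_nonneg (p := p) (by linarith)
  have hr : 1 ≤ p / 2 := by linarith
  have hsum (b : ι → ℝ) : 0 ≤ ∑ i ∈ s, b i ^ 2 := Finset.sum_nonneg fun _ _ => sq_nonneg _
  have e1 : (fun v : 𝕜 => ‖v‖ ^ p) = fun v => (RCLike.re v ^ 2 + RCLike.im v ^ 2) ^ (p / 2) := by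
    funext v
    rw [show RCLike.re v ^ 2 + RCLike.im v ^ 2 = ‖v‖ ^ 2 by
      rw [RCLike.norm_sq_eq_def]; ring, ← Real.rpow_natCast_mul (norm_nonneg _)]
    congr 1; push_cast; ring
  have e2 (x : ℝ) : (x ^ 2) ^ (p / 2) = |x| ^ p := by
    rw [← sq_abs, ← Real.rpow_natCast_mul (abs_nonneg _)]
    congr 1; push_cast; ring
  have key (L : 𝕜 →+ ℝ) : signMean s a (fun v => (L v ^ 2) ^ (p / 2)) ^ (1 / (p / 2)) ≤
      gaussianMoment p ^ (1 / (p / 2)) * ∑ i ∈ s, L (a i) ^ 2 := by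
    have h := signMean_abs_rpow_le hp s (fun i => L (a i))
    rw [signMean_map s a L fun v => |v| ^ p] at h
    simp only [e2]
    calc _ ≤ (gaussianMoment p * (∑ i ∈ s, L (a i) ^ 2) ^ (p / 2)) ^ (1 / (p / 2)) := by
          refine Real.rpow_le_rpow (signMean_nonneg _ _ fun v => by positivity) h (by positivity)
      _ = _ := by
          have h1 := hsum fun i => L (a i)
          rw [Real.mul_rpow hγ (by positivity), ← Real.rpow_mul h1,
            mul_one_div_cancel (by positivity), Real.rpow_one]
  -- Minkowski in L_{p/2} for re² + im²: the two real estimates add up to the sum of the ‖a_i‖², so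
  -- complex scalars cost no constant.
  have hm := signMean_add_rpow_le s a (f := fun v => RCLike.re v ^ 2) (g := fun v => RCLike.im v ^ 2)
    (fun v => sq_nonneg _) (fun v => sq_nonneg _) hr
  have k1 := key RCLike.re
  have k2 := key RCLike.im
  have e3 : ∑ i ∈ s, ‖a i‖ ^ 2 = ∑ i ∈ s, RCLike.re (a i) ^ 2 + ∑ i ∈ s, RCLike.im (a i) ^ 2 := by
    rw [← Finset.sum_add_distrib]
    exact Finset.sum_congr rfl fun i _ => by rw [RCLike.norm_sq_eq_def]; ring
  have h := hm.trans ((add_le_add k1 k2).trans_eq (by rw [← mul_add, ← e3]))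
  have hnn : 0 ≤ signMean s a fun v => (RCLike.re v ^ 2 + RCLike.im v ^ 2) ^ (p / 2) :=
    signMean_nonneg _ _ fun v => by positivity
  have hp0 : 0 < p / 2 := by linarith
  have hs0 := hsum fun i => ‖a i‖
  have h' := Real.rpow_le_rpow (by positivity) h hp0.le
  rw [← Real.rpow_mul hnn, one_div_mul_cancel hp0.ne', Real.rpow_one,
    Real.mul_rpow (by positivity) hs0, ← Real.rpow_mul hγ, one_div_mul_cancel hp0.ne',
    Real.rpow_one] at h'
  rw [e1]
  exact h'

theorem Lp_sum_le_of_nonneg {κ : Type*} (s : Finset ι) (F : Finset κ) {f : ι → κ → ℝ}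
    (hf : ∀ i k, 0 ≤ f i k) {r : ℝ} (hr : 1 ≤ r) :
    (∑ k ∈ F, (∑ i ∈ s, f i k) ^ r) ^ (1 / r) ≤ ∑ i ∈ s, (∑ k ∈ F, f i k ^ r) ^ (1 / r) := by
  induction s using Finset.induction_on with
  | empty =>
    have : r ≠ 0 := by linarith
    simp [Real.zero_rpow this, Real.zero_rpow (inv_ne_zero this)]
  | insert j s hj ih =>
    simp only [Finset.sum_insert hj]
    exact (Real.Lp_add_le_of_nonneg F hr (fun k _ => hf j k)
      fun k _ => Finset.sum_nonneg fun i _ => hf i k).trans (by gcongr)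

variable {𝕜 : Type*} [RCLike 𝕜] {p : ℝ≥0∞}

theorem hasSum_signMean_norm_rpow (hp : 0 < p.toReal) (s : Finset ι)
    (y : ι → lp (fun _ : ℕ => 𝕜) p) :
    HasSum (fun k => signMean s (fun i => y i k) (fun v => ‖v‖ ^ p.toReal))
      (signMean s y fun v => ‖v‖ ^ p.toReal) := by
  have h (k : ℕ) : signMean s (fun i => y i k) (fun v => ‖v‖ ^ p.toReal) =
      signMean s y (fun v => ‖v k‖ ^ p.toReal) :=
    signMean_map s y ⟨⟨fun v : lp (fun _ : ℕ => 𝕜) p => v k, rfl⟩, fun _ _ => rfl⟩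
      (fun v => ‖v‖ ^ p.toReal)
  simp only [h]
  simp only [signMean]
  exact (hasSum_sum fun A _ => lp.hasSum_norm hp _).div_const _

theorem signMean_lp_norm_rpow_le_of_le_two (hp : 0 < p.toReal) (hp2 : p.toReal ≤ 2) (s : Finset ι)
    (y : ι → lp (fun _ : ℕ => 𝕜) p) :
    signMean s y (fun v => ‖v‖ ^ p.toReal) ≤ ∑ i ∈ s, ‖y i‖ ^ p.toReal :=
  hasSum_le (fun k => signMean_norm_rpow_le_sum hp hp2 s fun i => y i k)
    (hasSum_signMean_norm_rpow hp s y) (hasSum_sum fun i _ => lp.hasSum_norm hp (y i))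

/-- Khintchine in each coordinate, then Minkowski in ℓ_{p/2} to interchange the sums over
coordinates and vectors. -/
theorem signMean_lp_norm_rpow_le_of_two_le (hp2 : 2 ≤ p.toReal) (s : Finset ι)
    (y : ι → lp (fun _ : ℕ => 𝕜) p) :
    signMean s y (fun v => ‖v‖ ^ p.toReal) ≤
      gaussianMoment p.toReal * (∑ i ∈ s, ‖y i‖ ^ 2) ^ (p.toReal / 2) := by
  have hp : 0 < p.toReal := by linarith
  have hγ := gaussianMoment_nonneg hp.le
  refine hasSum_le_of_sum_le (hasSum_signMean_norm_rpow hp s y) fun F => ?_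
  calc _ ≤ ∑ k ∈ F, gaussianMoment p.toReal * (∑ i ∈ s, ‖y i k‖ ^ 2) ^ (p.toReal / 2) :=
        Finset.sum_le_sum fun k _ => signMean_norm_rpow_le hp2 s fun i => y i k
    _ = gaussianMoment p.toReal * ∑ k ∈ F, (∑ i ∈ s, ‖y i k‖ ^ 2) ^ (p.toReal / 2) := by
        rw [Finset.mul_sum]
    _ ≤ _ := by
        refine mul_le_mul_of_nonneg_left ?_ hγ
        have hr : 0 < p.toReal / 2 := by linarith
        have h1 := Lp_sum_le_of_nonneg s F (f := fun i k => ‖y i k‖ ^ 2)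
          (fun i k => sq_nonneg _) (r := p.toReal / 2) (by linarith)
        have e (x : ℝ) (hx : 0 ≤ x) : (x ^ 2) ^ (p.toReal / 2) = x ^ p.toReal := by
          rw [← Real.rpow_natCast_mul hx]
          congr 1; push_cast; ring
        have h2 : ∀ i ∈ s, (∑ k ∈ F, (‖y i k‖ ^ 2) ^ (p.toReal / 2)) ^ (1 / (p.toReal / 2)) ≤
            ‖y i‖ ^ 2 := by
          intro i _
          rw [one_div, Real.rpow_inv_le_iff_of_pos (by positivity) (by positivity) hr,
            e _ (lp.norm_nonneg' _)]
          simp only [e _ (norm_nonneg _)]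
          exact lp.sum_rpow_le_norm_rpow hp (y i) F
        have h3 := h1.trans (Finset.sum_le_sum h2)
        rwa [one_div, Real.rpow_inv_le_iff_of_pos (by positivity) (by positivity) hr] at h3

end Averages

/-! ### Upper estimates for unconditional decompositions of ℓ_p, and the conclusion. -/

section Unconditional

variable {𝕜 E : Type*} [RCLike 𝕜] [NormedAddCommGroup E] [NormedSpace 𝕜 E]
  {𝔐 : ℕ → Submodule 𝕜 E} {M : ℝ}

/-- The terms with sign + and those with sign − are each, up to a global sign, a subsum of the
signed sum, so each costs a factor M. -/
theorem IsUnconditionalSchauderDecompositionWith.norm_sum_le_norm_sum_signs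
    (h𝔐 : IsUnconditionalSchauderDecompositionWith 𝔐 M) {A s : Finset ℕ} (hA : A ⊆ s) {y : ℕ → E}
    (hy : ∀ i, y i ∈ 𝔐 i) :
    ‖∑ i ∈ s, y i‖ ≤ 2 * M * ‖∑ i ∈ s, if i ∈ A then y i else -y i‖ := by
  have hz : ∀ i, (if i ∈ A then y i else -y i) ∈ 𝔐 i := fun i => by
    split_ifs
    · exact hy i
    · exact neg_mem (hy i)
  have h1 := h𝔐.norm_sum_subset_le hA hz
  have h2 := h𝔐.norm_sum_subset_le (Finset.sdiff_subset (s := s) (t := A)) hz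
  have e1 : ∑ i ∈ A, (if i ∈ A then y i else -y i) = ∑ i ∈ A, y i :=
    Finset.sum_congr rfl fun i hi => if_pos hi
  have e2 : ∑ i ∈ s \ A, (if i ∈ A then y i else -y i) = -∑ i ∈ s \ A, y i := by
    rw [← Finset.sum_neg_distrib]
    exact Finset.sum_congr rfl fun i hi => if_neg (Finset.mem_sdiff.1 hi).2
  rw [e1] at h1
  rw [e2, norm_neg] at h2
  rw [← Finset.sum_sdiff hA]
  exact (norm_add_le _ _).trans (by linarith)

theorem IsUnconditionalSchauderDecompositionWith.norm_sum_rpow_le_signMean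
    (h𝔐 : IsUnconditionalSchauderDecompositionWith 𝔐 M) (s : Finset ℕ) {y : ℕ → E}
    (hy : ∀ i, y i ∈ 𝔐 i) {p : ℝ} (hp : 0 < p) :
    ‖∑ i ∈ s, y i‖ ^ p ≤ (2 * M) ^ p * signMean s y (fun v => ‖v‖ ^ p) := by
  have hM := h𝔐.one_le
  rw [← signMean_const_mul]
  refine le_signMean fun A hA => ?_
  rw [← Real.mul_rpow (by linarith) (norm_nonneg _)]
  exact Real.rpow_le_rpow (norm_nonneg _) (h𝔐.norm_sum_le_norm_sum_signs hA hy) hp.le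

end Unconditional

section SequenceSpaces

variable {𝕜 : Type*} [RCLike 𝕜] {p : ℝ≥0∞} [Fact (1 ≤ p)]
  {𝔐 : ℕ → Submodule 𝕜 (lp (fun _ : ℕ => 𝕜) p)} {M : ℝ}

theorem IsUnconditionalSchauderDecompositionWith.norm_sum_le_of_le_two
    (h𝔐 : IsUnconditionalSchauderDecompositionWith 𝔐 M) (hp : 0 < p.toReal) (hp2 : p.toReal ≤ 2)
    (s : Finset ℕ) {y : ℕ → lp (fun _ : ℕ => 𝕜) p} (hy : ∀ i, y i ∈ 𝔐 i) :
    ‖∑ i ∈ s, y i‖ ≤ 2 * M * (∑ i ∈ s, ‖y i‖ ^ p.toReal) ^ (1 / p.toReal) := by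
  have hM : 0 ≤ 2 * M := by linarith [h𝔐.one_le]
  have h := (h𝔐.norm_sum_rpow_le_signMean s hy hp).trans (mul_le_mul_of_nonneg_left
    (signMean_lp_norm_rpow_le_of_le_two hp hp2 s y) (Real.rpow_nonneg hM _))
  rw [Real.le_rpow_inv_iff_of_pos (norm_nonneg _) (by positivity) hp |>.symm] at h
  rwa [← one_div, Real.mul_rpow (by positivity) (by positivity), ← Real.rpow_mul hM,
    mul_one_div_cancel hp.ne', Real.rpow_one] at h

theorem IsUnconditionalSchauderDecompositionWith.norm_sum_le_of_two_le
    (h𝔐 : IsUnconditionalSchauderDecompositionWith 𝔐 M) (hp2 : 2 ≤ p.toReal)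
    (s : Finset ℕ) {y : ℕ → lp (fun _ : ℕ => 𝕜) p} (hy : ∀ i, y i ∈ 𝔐 i) :
    ‖∑ i ∈ s, y i‖ ≤ 2 * M * gaussianMoment p.toReal ^ (1 / p.toReal) *
      (∑ i ∈ s, ‖y i‖ ^ (2 : ℝ)) ^ (1 / (2 : ℝ)) := by
  have hp : 0 < p.toReal := by linarith
  have hM : 0 ≤ 2 * M := by linarith [h𝔐.one_le]
  have hγ := gaussianMoment_nonneg hp.le
  have h := (h𝔐.norm_sum_rpow_le_signMean s hy hp).trans (mul_le_mul_of_nonneg_left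
    (signMean_lp_norm_rpow_le_of_two_le hp2 s y) (Real.rpow_nonneg hM _))
  rw [Real.le_rpow_inv_iff_of_pos (norm_nonneg _) (by positivity) hp |>.symm] at h
  rw [← one_div, Real.mul_rpow (by positivity) (by positivity), ← Real.rpow_mul hM,
    mul_one_div_cancel hp.ne', Real.rpow_one, Real.mul_rpow hγ (by positivity),
    ← Real.rpow_mul (by positivity), show p.toReal / 2 * (1 / p.toReal) = 1 / 2 by field_simp,
    ← mul_assoc] at h
  simpa only [Real.rpow_two] using h

theorem finrank_le_of_proj_eq_truncation (h𝔐 : IsSchauderDecomposition 𝔐)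
    {P : ℕ → lp (fun _ : ℕ => 𝕜) p →ₗ[𝕜] lp (fun _ : ℕ => 𝕜) p}
    (hP : IsCoordinateProjections 𝔐 P) {m : ℕ}
    (hP₀ : ∀ (x : lp (fun _ : ℕ => 𝕜) p) (i : ℕ), P 0 x i = if i < m then x i else 0) :
    FiniteDimensional 𝕜 (𝔐 0) ∧ Module.finrank 𝕜 (𝔐 0) ≤ m := by
  let f : 𝔐 0 →ₗ[𝕜] (Fin m → 𝕜) :=
    { toFun := fun x i => (x : lp (fun _ : ℕ => 𝕜) p) i
      map_add' := fun x y => rfl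
      map_smul' := fun a x => rfl }
  have hf : Function.Injective f := by
    rw [injective_iff_map_eq_zero]
    intro x hx
    have h1 : P 0 (x : lp (fun _ : ℕ => 𝕜) p) = x := by
      simpa using hP.apply_of_mem h𝔐 x.2 0
    refine Subtype.ext (lp.ext (funext fun i => ?_))
    rw [← h1, hP₀]
    split_ifs with h
    · exact congrFun hx ⟨i, h⟩
    · rfl
  refine ⟨FiniteDimensional.of_injective f hf, ?_⟩
  simpa using LinearMap.finrank_le_finrank_of_injective hf

end SequenceSpaces

theorem theorem5p4 {𝕜 : Type*} [RCLike 𝕜] {p : ℝ≥0∞} [Fact (1 ≤ p)] (hp : p ≠ ∞)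
    (𝔐 : ℕ → Submodule 𝕜 (lp (fun _ : ℕ => 𝕜) p)) (M : ℝ)
    (h𝔐 : IsUnconditionalSchauderDecompositionWith 𝔐 M)
    (P : ℕ → lp (fun _ : ℕ => 𝕜) p →ₗ[𝕜] lp (fun _ : ℕ => 𝕜) p)
    (hP : IsCoordinateProjections 𝔐 P)
    (m : ℕ)
    (hP₀ : ∀ (x : lp (fun _ : ℕ => 𝕜) p) (i : ℕ), P 0 x i = if i < m then x i else 0)
    (J : ℕ → lp (fun _ : ℕ => 𝕜) p →L[𝕜] lp (fun _ : ℕ => 𝕜) p)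
    (hJ_ne : ∀ n, J n ≠ 0)
    (hJ : ∀ n k, (J n).comp (J k) = if n = k then J n else 0)
    (hJ₀ : Module.rank 𝕜 (LinearMap.range (J 0).toLinearMap) = m) :
    (p ≤ 2 → ∀ ς₁ : ℝ, 0 ≤ ς₁ → ς₁ < (2 * M)⁻¹ →
      (∀ x : lp (fun _ : ℕ => 𝕜) p,
        Summable (fun n : ℕ => ‖P (n + 1) (J (n + 1) x - P (n + 1) x)‖ ^ p.toReal) ∧
        (∑' n : ℕ, ‖P (n + 1) (J (n + 1) x - P (n + 1) x)‖ ^ p.toReal) ^ (1 / p.toReal)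
          ≤ ς₁ * ‖x‖) →
      IsUnconditionalSchauderDecomposition
          (fun n => LinearMap.range (J n).toLinearMap) ∧
        AreIsomorphicDecompositions 𝔐
          (fun n => LinearMap.range (J n).toLinearMap)) ∧
    (2 ≤ p → ∀ ς₂ : ℝ, 0 ≤ ς₂ →
      ς₂ < 1 / (√8 * M) *
        (Real.Gamma ((p.toReal + 1) / 2) / √Real.pi) ^ (-(1 / p.toReal)) →
      (∀ x : lp (fun _ : ℕ => 𝕜) p,
        Summable (fun n : ℕ => ‖P (n + 1) (J (n + 1) x - P (n + 1) x)‖ ^ 2) ∧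
        (∑' n : ℕ, ‖P (n + 1) (J (n + 1) x - P (n + 1) x)‖ ^ 2) ^ (1 / 2 : ℝ)
          ≤ ς₂ * ‖x‖) →
      IsUnconditionalSchauderDecomposition
          (fun n => LinearMap.range (J n).toLinearMap) ∧
        AreIsomorphicDecompositions 𝔐
          (fun n => LinearMap.range (J n).toLinearMap)) := by
  have hM : 0 < M := lt_of_lt_of_le one_pos h𝔐.one_le
  have hp1 : 1 ≤ p.toReal := by
    simpa using ENNReal.toReal_mono hp (Fact.out : 1 ≤ p)
  have hp0 : 0 < p.toReal := by linarith
  obtain ⟨hfin, hrank⟩ := finrank_le_of_proj_eq_truncation h𝔐.toIsSchauderDecomposition hP hP₀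
  refine ⟨fun hp2 c hc hcM hJP => ?_, fun hp2 c hc hcM hJP => ?_⟩
  · have hp2' : p.toReal ≤ 2 := by simpa using ENNReal.toReal_mono (by simp) hp2
    refine isUnconditional_and_areIsomorphic_of_norm_sum_le h𝔐 hP hp0 (K := 2 * M) (by positivity)
      ?_ hc (fun s y hy => h𝔐.norm_sum_le_of_le_two hp0 hp2' s hy) hfin hrank hJ hJ₀ hJP
    rw [← one_div, lt_div_iff₀ (by positivity)] at hcM
    linarith
  · have hp2' : 2 ≤ p.toReal := by simpa using ENNReal.toReal_mono hp hp2
    have hΓ : 0 < Real.Gamma ((p.toReal + 1) / 2) / √π :=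
      div_pos (Real.Gamma_pos_of_pos (by linarith)) (Real.sqrt_pos.2 Real.pi_pos)
    have hγ := gaussianMoment_nonneg hp0.le
    refine isUnconditional_and_areIsomorphic_of_norm_sum_le h𝔐 hP (q := 2) two_pos
      (K := 2 * M * gaussianMoment p.toReal ^ (1 / p.toReal)) (by positivity) ?_ hc
      (fun s y hy => h𝔐.norm_sum_le_of_two_le hp2' s hy) hfin hrank hJ hJ₀
      (fun x => by simpa only [Real.rpow_two] using hJP x)
    -- The factor 2^(p/2) in the Gaussian moment contributes √2 after the p-th root, and 2√2 = √8.
    have e : 2 * M * gaussianMoment p.toReal ^ (1 / p.toReal) =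
        √8 * M * (Real.Gamma ((p.toReal + 1) / 2) / √π) ^ (1 / p.toReal) := by
      have h8 : √8 = 2 * √2 := by
        rw [show (8 : ℝ) = 2 ^ 2 * 2 by norm_num, Real.sqrt_mul (by norm_num),
          Real.sqrt_sq (by norm_num)]
      rw [gaussianMoment, mul_div_assoc, Real.mul_rpow (by positivity) hΓ.le,
        ← Real.rpow_mul (by norm_num), h8, Real.sqrt_eq_rpow 2,
        show p.toReal / 2 * (1 / p.toReal) = 1 / 2 by field_simp]
      ring
    have h8 : 0 < √8 * M := mul_pos (Real.sqrt_pos.2 (by norm_num)) hM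
    rw [e]
    rw [Real.rpow_neg hΓ.le, ← one_div, one_div_mul_one_div, lt_div_iff₀ (by positivity)] at hcM
    linarith
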